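/- Let $p$ be a prime, $n\ge 1$, $G=C_{p^n}$ a cyclic group of order $p^n$, and $C_p\le G$ its subgroup of order $p$; write $C_{p^{n-1}}=G/C_p$. A nonzero Tambara functor $k$ is *field-like* (a *Tambara field*) if every morphism from $k$ to a nonzero Tambara functor is monic. A Tambara field $k$ is *clarified* if the $G$-ring $k(G/e)$ is not isomorphic to $\mathrm{Coind}_H^G R$ for any proper subgroup $H$ and $H$-ring $R$. It has characteristic $p$ if the ring $k(G/e)$ has characteristic $p$. A *compatible triple* consists of a clarified $C_{p^{n-1}}$-Tambara field $\ell_t$ of characteristic $p$, a field $\mathbb F$ with an action of $C_{p^n}$, and a clarified $C_p$-Tambara field $\ell_b$ of characteristic $p$, together with a ring isomorphism $\ell_t(C_{p^{n-1}}/e)\cong \ell_b(C_p/C_p)$ and a $C_p$-equivariant ring isomorphism $\ell_b(C_p/e)\cong \mathrm{Res}^{C_{p^n}}_{C_p}\mathbb F$, such that the ring map $$\ell_t(C_{p^{n-1}}/e)\cong \ell_b(C_p/C_p)\xrightarrow{\ \mathrm{res}\ }\ell_b(C_p/e)\cong\mathbb F$$ is equivariant, where $C_{p^n}$ acts on the source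 through its quotient $C_{p^{n-1}}$. An isomorphism of triples consists of isomorphisms of the three entries (the one of the fields being $C_{p^n}$-equivariant) that commute with the two identifications. For a $C_{p^n}$-Tambara functor $k$ let $\ell_t(k)$ be the $C_{p^{n-1}}$-Tambara functor obtained by regarding $C_{p^{n-1}}$-sets as $C_{p^n}$-sets, so that $\ell_t(k)(C_{p^{n-1}}/C_{p^{s-1}})=k(C_{p^n}/C_{p^s})$ for $1\le s\le n$, with the restrictions, norms and transfers of $k$. Let $\ell_b(k)=\mathrm{Res}^{C_{p^n}}_{C_p}k$. **Proposition.** Every clarified $C_{p^n}$-Tambara field of characteristic $p$ is obtained from a compatible triple, uniquely up to isomorphism. Precisely: 1. If $k$ is a clarified $C_{p^n}$-Tambara field of characteristic $p$, then $(\ell_t(k),\,k(C_{p^n}/e),\,\ell_b(k))$, with the canonical identifications, is a compatible triple. 2. Every compatible triple is isomorphic to the triple of some clarified $C_{p^n}$-Tambara field $k$ of characteristic $p$. 3. If $k,k'$ are clarified $C_{p^n}$-Tambara fields of characteristic $p$, then every isomorphism between their triples is induced by a unique isomorphism $k\cong k'$. Recursively, this reduces the classification to $C_p$: a $C_{p^n}$-Tambara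 functor is a clarified Tambara field of characteristic $p$ if and only if it belongs to the smallest class of Tambara functors for cyclic $p$-groups that contains the clarified $C_p$-Tambara fields of characteristic $p$ and contains each $C_{p^m}$-Tambara functor $k$ ($m\ge 2$) whose triple is isomorphic to a compatible triple $(\ell_t,\mathbb F,\ell_b)$ with $\ell_t$ in the class. -/

import Mathlib

open CategoryTheory

universe u

/-! ## Finite `G`-sets -/

/-- A finite set with an action of `G`. Morphisms are the equivariant maps `X →[G] Y`. -/
structure FinGSet (G : Type) [Group G] where
  carrier : Type
  [mulAction : MulAction G carrier]
  [finite : Finite carrier]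

namespace FinGSet

instance (G : Type) [Group G] : CoeSort (FinGSet G) Type := ⟨FinGSet.carrier⟩

attribute [instance] FinGSet.mulAction FinGSet.finite

/-- The orbit `G/e`: the group `G` with its action on itself by left multiplication. -/
abbrev free (G : Type) [Group G] [Finite G] : FinGSet G where
  carrier := G

/-- The orbit `G/G`: the one-point `G`-set. -/
abbrev point (G : Type) [Group G] : FinGSet G where
  carrier := PUnit

/-- The unique map `G/e → G/G`. -/
def toPoint (G : Type) [Group G] [Finite G] : free G →[G] point G where
  toFun _ := PUnit.unit
  map_smul' _ _ := rfl

/-- Right multiplication by `g`, an automorphism of the `G`-set `G/e`. -/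
def rightMul {G : Type} [Group G] [Finite G] (g : G) : free G →[G] free G where
  toFun x := x * g
  map_smul' a x := mul_assoc a x g

section Diagrams

variable {G : Type} [Group G]

/-- `Z` is the disjoint union of `X` and `Y` via `i` and `j`. -/
def IsDisjointUnion {X Y Z : FinGSet G} (i : X →[G] Z) (j : Y →[G] Z) : Prop :=
  Function.Bijective (Sum.elim i j : X ⊕ Y → Z)

/-- The square with `p : W → X`, `q : W → Y`, `f : X → Z`, `g : Y → Z` commutes and is a pullback
square. -/
def IsCartesian {W X Y Z : FinGSet G} (p : W →[G] X) (q : W →[G] Y)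
    (f : X →[G] Z) (g : Y →[G] Z) : Prop :=
  (∀ w, f (p w) = g (q w)) ∧ ∀ x y, f x = g y → ∃! w, p w = x ∧ q w = y

/-- The diagram
```
  A <--e-- P --q--> B
  |f                |h
  v                 v
  X -------g------> Y
```
with `p = f ∘ e : P → X` is an exponential diagram: `P` is the pullback of `g` and `h`, and the
fibre of `h` over `y` is the set of sections of `f` over the fibre of `g` at `y`, the bijection
being given by the evaluation map `e`. In other words `B` is the dependent product of `A`
along `g`. -/
def IsExponential {A X Y B P : FinGSet G} (f : A →[G] X) (g : X →[G] Y) (h : B →[G] Y)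
    (p : P →[G] X) (q : P →[G] B) (e : P →[G] A) : Prop :=
  IsCartesian p q g h ∧ (∀ r, f (e r) = p r) ∧
    ∀ (y : Y) (s : {x : X // g x = y} → A), (∀ x, f (s x) = x) →
      ∃! b : B, h b = y ∧ ∀ (x : {x : X // g x = y}) (r : P), p r = x → q r = b → e r = s x

end Diagrams

end FinGSet

/-! ## Tambara functors -/

/-- A `G`-Tambara functor: commutative rings `k(X)` for all finite `G`-sets `X`, with restrictions,
transfers and norms along all equivariant maps, such that disjoint unions go to products, the
base change formulae hold for pullback squares, and the distributive law holds for
exponential diagrams. -/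
structure TambaraFunctor (G : Type) [Group G] where
  obj : FinGSet G → Type u
  [commRing : ∀ X, CommRing (obj X)]
  res : ∀ {X Y : FinGSet G}, (X →[G] Y) → (obj Y →+* obj X)
  tr : ∀ {X Y : FinGSet G}, (X →[G] Y) → (obj X →+ obj Y)
  nm : ∀ {X Y : FinGSet G}, (X →[G] Y) → (obj X →* obj Y)
  res_id : ∀ (X : FinGSet G) (a : obj X), res (MulActionHom.id G : X →[G] X) a = a
  tr_id : ∀ (X : FinGSet G) (a : obj X), tr (MulActionHom.id G : X →[G] X) a = a
  nm_id : ∀ (X : FinGSet G) (a : obj X), nm (MulActionHom.id G : X →[G] X) a = a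
  res_comp : ∀ {X Y Z : FinGSet G} (g : Y →[G] Z) (f : X →[G] Y) (a : obj Z),
    res (g.comp f) a = res f (res g a)
  tr_comp : ∀ {X Y Z : FinGSet G} (g : Y →[G] Z) (f : X →[G] Y) (a : obj X),
    tr (g.comp f) a = tr g (tr f a)
  nm_comp : ∀ {X Y Z : FinGSet G} (g : Y →[G] Z) (f : X →[G] Y) (a : obj X),
    nm (g.comp f) a = nm g (nm f a)
  subsingleton_of_isEmpty : ∀ X : FinGSet G, IsEmpty X → Subsingleton (obj X)
  bijective_of_isDisjointUnion : ∀ {X Y Z : FinGSet G} (i : X →[G] Z) (j : Y →[G] Z),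
    FinGSet.IsDisjointUnion i j →
      Function.Bijective (fun a : obj Z => ((res i a, res j a) : obj X × obj Y))
  res_tr : ∀ {W X Y Z : FinGSet G} (p : W →[G] X) (q : W →[G] Y) (f : X →[G] Z) (g : Y →[G] Z),
    FinGSet.IsCartesian p q f g → ∀ a : obj X, res g (tr f a) = tr q (res p a)
  res_nm : ∀ {W X Y Z : FinGSet G} (p : W →[G] X) (q : W →[G] Y) (f : X →[G] Z) (g : Y →[G] Z),
    FinGSet.IsCartesian p q f g → ∀ a : obj X, res g (nm f a) = nm q (res p a)
  nm_tr : ∀ {A X Y B P : FinGSet G} (f : A →[G] X) (g : X →[G] Y) (h : B →[G] Y)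
    (p : P →[G] X) (q : P →[G] B) (e : P →[G] A), FinGSet.IsExponential f g h p q e →
      ∀ a : obj A, nm g (tr f a) = tr h (nm q (res e a))

namespace TambaraFunctor

attribute [instance] TambaraFunctor.commRing

section Category

variable {G : Type} [Group G]

/-- A morphism of Tambara functors: ring maps commuting with restrictions, transfers and norms. -/
@[ext]
structure Hom (k l : TambaraFunctor.{u} G) where
  app : ∀ X : FinGSet G, k.obj X →+* l.obj X
  app_res : ∀ {X Y : FinGSet G} (f : X →[G] Y) (a : k.obj Y),
    app X (k.res f a) = l.res f (app Y a)
  app_tr : ∀ {X Y : FinGSet G} (f : X →[G] Y) (a : k.obj X),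
    app Y (k.tr f a) = l.tr f (app X a)
  app_nm : ∀ {X Y : FinGSet G} (f : X →[G] Y) (a : k.obj X),
    app Y (k.nm f a) = l.nm f (app X a)

instance : Category (TambaraFunctor.{u} G) where
  Hom := Hom
  id k :=
    { app := fun X => RingHom.id (k.obj X)
      app_res := fun _ _ => rfl
      app_tr := fun _ _ => rfl
      app_nm := fun _ _ => rfl }
  comp φ ψ :=
    { app := fun X => (ψ.app X).comp (φ.app X)
      app_res := fun f a => by simp [φ.app_res, ψ.app_res]
      app_tr := fun f a => by simp [φ.app_tr, ψ.app_tr]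
      app_nm := fun f a => by simp [φ.app_nm, ψ.app_nm] }

/-- A Tambara functor is nonzero if some of its rings is nonzero. -/
def IsNonzero (k : TambaraFunctor.{u} G) : Prop := ∃ X, Nontrivial (k.obj X)

/-- Field-like Tambara functors (Tambara fields): `k` is nonzero and every morphism from `k` to
a nonzero Tambara functor is monic. -/
def IsFieldLike (k : TambaraFunctor.{u} G) : Prop :=
  k.IsNonzero ∧ ∀ (l : TambaraFunctor.{u} G) (φ : k ⟶ l), l.IsNonzero → Mono φ

/-- Mutually inverse maps of finite `G`-sets give an isomorphism of rings by restriction. -/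
def resEquiv (k : TambaraFunctor.{u} G) {X Y : FinGSet G} (f : X →[G] Y) (g : Y →[G] X)
    (hgf : ∀ x, g (f x) = x) (hfg : ∀ y, f (g y) = y) : k.obj Y ≃+* k.obj X where
  toFun := k.res f
  invFun := k.res g
  left_inv a := by
    have h : f.comp g = MulActionHom.id G := MulActionHom.ext hfg
    rw [← k.res_comp, h, k.res_id]
  right_inv a := by
    have h : g.comp f = MulActionHom.id G := MulActionHom.ext hgf
    rw [← k.res_comp, h, k.res_id]
  map_mul' := map_mul _
  map_add' := map_add _

end Category

section Bottom

variable {G : Type} [Group G] [Finite G]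

/-- The ring `k(G/e)`. -/
abbrev bottom (k : TambaraFunctor.{u} G) : Type u := k.obj (FinGSet.free G)

/-- The ring `k(G/G)`. -/
abbrev topLevel (k : TambaraFunctor.{u} G) : Type u := k.obj (FinGSet.point G)

/-- The restriction `k(G/G) → k(G/e)`. -/
def resTopBottom (k : TambaraFunctor.{u} G) : k.topLevel →+* k.bottom :=
  k.res (FinGSet.toPoint G)

/-- The action of the Weyl group `G` of the trivial subgroup on `k(G/e)`: the element `g` acts by
restriction along the automorphism `x ↦ x * g` of `G/e`. -/
instance bottomAction (k : TambaraFunctor.{u} G) : MulSemiringAction G k.bottom where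
  smul g a := k.res (FinGSet.rightMul g) a
  one_smul a := by
    have h : (FinGSet.rightMul (1 : G)) = MulActionHom.id G := MulActionHom.ext fun x => mul_one x
    change k.res _ a = a
    rw [h, k.res_id]
  mul_smul g g' a := by
    have h : FinGSet.rightMul (g * g') = (FinGSet.rightMul g').comp (FinGSet.rightMul g) :=
      MulActionHom.ext fun x => (mul_assoc x g g').symm
    change k.res _ a = k.res _ (k.res _ a)
    rw [h, k.res_comp]
  smul_zero g := map_zero (k.res _)
  smul_add g := map_add (k.res _)
  smul_one g := map_one (k.res _)
  smul_mul g := map_mul (k.res _)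

end Bottom

end TambaraFunctor

/-! ## Coinduced rings and clarified Tambara fields -/

/-- The coinduction of an `H`-ring `R` to a `G`-ring: the ring of `H`-equivariant functions
`G → R`. Choosing coset representatives identifies it with the ring of functions `G/H → R`. -/
def coindRing {G : Type} [Group G] (H : Subgroup G) (R : Type u) [CommRing R]
    [MulSemiringAction H R] : Subring (G → R) where
  carrier := {f | ∀ (h : H) (x : G), f ((h : G) * x) = h • f x}
  mul_mem' hf hg h x := by simp [hf h x, hg h x]
  one_mem' h x := by simp
  add_mem' hf hg h x := by simp [hf h x, hg h x]
  zero_mem' h x := by simp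
  neg_mem' hf h x := by simp [hf h x]

/-- The action of `G` on the coinduction by right translation: `(g • f) x = f (x * g)`. -/
instance coindRing.action {G : Type} [Group G] (H : Subgroup G) (R : Type u) [CommRing R]
    [MulSemiringAction H R] : MulSemiringAction G (coindRing H R) where
  smul g f := ⟨fun x => f.1 (x * g), fun h x => by
    simpa [mul_assoc] using f.2 h (x * g)⟩
  one_smul f := Subtype.ext <| funext fun x => congrArg f.1 (mul_one x)
  mul_smul g g' f := Subtype.ext <| funext fun x => congrArg f.1 (mul_assoc x g g').symm
  smul_zero _ := rfl
  smul_add _ _ _ := rfl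
  smul_one _ := rfl
  smul_mul _ _ _ := rfl

namespace TambaraFunctor

variable {G : Type} [Group G] [Finite G]

/-- `k(G/e)` is isomorphic, as a `G`-ring, to a ring coinduced from a proper subgroup. -/
def IsSeparated (k : TambaraFunctor.{u} G) : Prop :=
  ∃ (H : Subgroup G) (_ : H ≠ ⊤) (R : Type u) (_ : CommRing R) (_ : MulSemiringAction H R)
    (ε : k.bottom ≃+* coindRing H R), ∀ (g : G) (a : k.bottom), ε (g • a) = g • ε a

/-- `k` is a clarified Tambara field: it is field-like and not separated. -/
def IsClarified (k : TambaraFunctor.{u} G) : Prop :=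
  k.IsFieldLike ∧ ¬ k.IsSeparated

/-- `k` is a clarified Tambara field of characteristic `p`. The characteristic of a Tambara field
is that of the ring `k(G/e)`. -/
def IsClarifiedOfChar (p : ℕ) (k : TambaraFunctor.{u} G) : Prop :=
  k.IsClarified ∧ CharP k.bottom p

end TambaraFunctor

/-! ## Restriction to a subgroup and the functor of a quotient group -/

/-- A functor from finite `H`-sets to finite `G`-sets which preserves empty sets, disjoint unions,
pullback squares and exponential diagrams. -/
structure GSetFunctor (H G : Type) [Group H] [Group G] where
  obj : FinGSet H → FinGSet G
  map : ∀ {X Y : FinGSet H}, (X →[H] Y) → (obj X →[G] obj Y)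
  map_id : ∀ X : FinGSet H, map (MulActionHom.id H : X →[H] X) = MulActionHom.id G
  map_comp : ∀ {X Y Z : FinGSet H} (g : Y →[H] Z) (f : X →[H] Y),
    map (g.comp f) = (map g).comp (map f)
  isEmpty : ∀ X : FinGSet H, IsEmpty X → IsEmpty (obj X)
  isDisjointUnion : ∀ {X Y Z : FinGSet H} (i : X →[H] Z) (j : Y →[H] Z),
    FinGSet.IsDisjointUnion i j → FinGSet.IsDisjointUnion (map i) (map j)
  isCartesian : ∀ {W X Y Z : FinGSet H} (p : W →[H] X) (q : W →[H] Y)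
    (f : X →[H] Z) (g : Y →[H] Z), FinGSet.IsCartesian p q f g →
      FinGSet.IsCartesian (map p) (map q) (map f) (map g)
  isExponential : ∀ {A X Y B P : FinGSet H} (f : A →[H] X) (g : X →[H] Y) (h : B →[H] Y)
    (p : P →[H] X) (q : P →[H] B) (e : P →[H] A), FinGSet.IsExponential f g h p q e →
      FinGSet.IsExponential (map f) (map g) (map h) (map p) (map q) (map e)

/-- Precomposition of a Tambara functor with a functor of finite sets with group action. -/
def TambaraFunctor.precomp {H G : Type} [Group H] [Group G] (k : TambaraFunctor.{u} G)
    (Φ : GSetFunctor H G) : TambaraFunctor.{u} H where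
  obj X := k.obj (Φ.obj X)
  commRing X := k.commRing (Φ.obj X)
  res f := k.res (Φ.map f)
  tr f := k.tr (Φ.map f)
  nm f := k.nm (Φ.map f)
  res_id X a := by rw [Φ.map_id, k.res_id]
  tr_id X a := by rw [Φ.map_id, k.tr_id]
  nm_id X a := by rw [Φ.map_id, k.nm_id]
  res_comp g f a := by rw [Φ.map_comp, k.res_comp]
  tr_comp g f a := by rw [Φ.map_comp, k.tr_comp]
  nm_comp g f a := by rw [Φ.map_comp, k.nm_comp]
  subsingleton_of_isEmpty X hX := k.subsingleton_of_isEmpty _ (Φ.isEmpty X hX)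
  bijective_of_isDisjointUnion i j h :=
    k.bijective_of_isDisjointUnion _ _ (Φ.isDisjointUnion i j h)
  res_tr p q f g h := k.res_tr _ _ _ _ (Φ.isCartesian p q f g h)
  res_nm p q f g h := k.res_nm _ _ _ _ (Φ.isCartesian p q f g h)
  nm_tr f g h p q e he := k.nm_tr _ _ _ _ _ _ (Φ.isExponential f g h p q e he)

section Inflation

variable {G : Type} [Group G] (N : Subgroup G) [N.Normal]

/-- A finite `G/N`-set regarded as a finite `G`-set. -/
def FinGSet.inflate (X : FinGSet (G ⧸ N)) : FinGSet G where
  carrier := X.carrier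
  mulAction := MulAction.compHom X.carrier (QuotientGroup.mk' N)
  finite := X.finite

/-- An equivariant map of `G/N`-sets regarded as an equivariant map of `G`-sets. -/
def FinGSet.inflateMap {X Y : FinGSet (G ⧸ N)} (f : X →[G ⧸ N] Y) :
    FinGSet.inflate N X →[G] FinGSet.inflate N Y where
  toFun := (f : X.carrier → Y.carrier)
  map_smul' g x := f.map_smul' (QuotientGroup.mk' N g) x

/-- Inflation of finite sets with group action from `G/N` to `G`. -/
def GSetFunctor.inflation : GSetFunctor (G ⧸ N) G where
  obj := FinGSet.inflate N
  map := FinGSet.inflateMap N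
  map_id _ := rfl
  map_comp _ _ := rfl
  isEmpty _ h := h
  isDisjointUnion _ _ h := h
  isCartesian _ _ _ _ h := h
  isExponential _ _ _ _ _ _ h := h

/-- The `G/N`-Tambara functor whose value at the orbit `(G/N)/(H/N)`, for `N ≤ H ≤ G`, is
`k(G/H)`, with the restrictions, transfers and norms of `k`. -/
def TambaraFunctor.topPiece (k : TambaraFunctor.{u} G) : TambaraFunctor.{u} (G ⧸ N) :=
  k.precomp (GSetFunctor.inflation N)

end Inflation

section Induction

variable {G : Type} [Group G] (H : Subgroup G)

/-- The relation `(g * h, x) ∼ (g, h • x)` for `h ∈ H` on `G × X`. -/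
def FinGSet.indSetoid (X : FinGSet H) : Setoid (G × X) where
  r a b := ∃ h : H, a.1 = b.1 * h ∧ h • a.2 = b.2
  iseqv :=
    { refl := fun a => ⟨1, by simp, by simp⟩
      symm := by
        rintro ⟨a, x⟩ ⟨b, y⟩ ⟨h, h₁, h₂⟩
        refine ⟨h⁻¹, ?_, ?_⟩
        · simp only at h₁; simp [h₁]
        · simp only at h₂; simp [← h₂]
      trans := by
        rintro ⟨a, x⟩ ⟨b, y⟩ ⟨c, z⟩ ⟨h, h₁, h₂⟩ ⟨h', h₁', h₂'⟩
        refine ⟨h' * h, ?_, ?_⟩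
        · simp only at h₁ h₁'; simp [h₁, h₁', mul_assoc]
        · simp only at h₂ h₂'; simp [mul_smul, h₂, h₂'] }

variable [Finite G]

/-- The induced `G`-set `G ×_H X`. -/
def FinGSet.ind (X : FinGSet H) : FinGSet G where
  carrier := Quotient (FinGSet.indSetoid H X)
  mulAction :=
    { smul := fun g => Quotient.map (fun a => (g * a.1, a.2)) (by
        rintro ⟨a, x⟩ ⟨b, y⟩ ⟨h, h₁, h₂⟩
        exact ⟨h, by simp only at h₁; simp [h₁, mul_assoc], h₂⟩)
      one_smul := by
        rintro ⟨a, x⟩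
        exact congrArg (Quotient.mk _) (Prod.ext (one_mul a) rfl)
      mul_smul := by
        rintro g g' ⟨a, x⟩
        exact congrArg (Quotient.mk _) (Prod.ext (mul_assoc g g' a) rfl) }
  finite := inferInstance

namespace FinGSet

variable {H}

/-- The class of `(g, x)` in `G ×_H X`. -/
def indMk {X : FinGSet H} (g : G) (x : X) : ind H X :=
  Quotient.mk (indSetoid H X) (g, x)

theorem indMk_eq_iff {X : FinGSet H} {g g' : G} {x x' : X} :
    (indMk g x = indMk g' x') ↔ ∃ h : H, g = g' * h ∧ h • x = x' :=
  Quotient.eq (r := indSetoid H X)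

theorem indMk_surj {X : FinGSet H} (z : ind H X) : ∃ (g : G) (x : X), indMk g x = z := by
  obtain ⟨⟨g, x⟩, rfl⟩ := Quotient.exists_rep z
  exact ⟨g, x, rfl⟩

theorem smul_indMk {X : FinGSet H} (a g : G) (x : X) :
    a • (indMk g x : ind H X) = indMk (a * g) x := rfl

theorem indMk_inj {X : FinGSet H} {g : G} {x x' : X} (h : indMk g x = indMk g x') : x = x' := by
  obtain ⟨t, h₁, h₂⟩ := indMk_eq_iff.1 h
  have ht : t = 1 := by
    apply Subtype.ext
    simpa using h₁.symm
  simpa [ht] using h₂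

theorem indMk_mul {X : FinGSet H} (g : G) (t : H) (x : X) :
    indMk (g * t) x = indMk g (t • x) :=
  indMk_eq_iff.2 ⟨t, rfl, rfl⟩

/-- Functoriality of `G ×_H X` in `X`. -/
def indMap {X Y : FinGSet H} (f : X →[H] Y) : ind H X →[G] ind H Y where
  toFun := Quotient.map (fun a => (a.1, f a.2)) (by
    rintro ⟨a, x⟩ ⟨b, y⟩ ⟨h, h₁, h₂⟩
    refine ⟨h, h₁, ?_⟩
    simp only at h₂ ⊢
    rw [← h₂, map_smul])
  map_smul' := by
    rintro g ⟨a, x⟩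
    rfl

theorem indMap_mk {X Y : FinGSet H} (f : X →[H] Y) (g : G) (x : X) :
    indMap f (indMk g x) = indMk g (f x) := rfl

/-- Any element over `indMk g y` has a representative with first coordinate `g`. -/
theorem exists_of_indMap_eq {X Y : FinGSet H} (f : X →[H] Y) {z : ind H X} {g : G} {y : Y}
    (h : indMap f z = indMk g y) : ∃ x : X, indMk g x = z ∧ f x = y := by
  obtain ⟨a, x, rfl⟩ := indMk_surj z
  rw [indMap_mk] at h
  obtain ⟨t, rfl, h₂⟩ := indMk_eq_iff.1 h
  exact ⟨t • x, (indMk_mul g t x).symm, by rw [map_smul, h₂]⟩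

theorem indMap_isDisjointUnion {X Y Z : FinGSet H} (i : X →[H] Z) (j : Y →[H] Z)
    (h : IsDisjointUnion i j) : IsDisjointUnion (indMap i) (indMap j) := by
  constructor
  · rintro (x | x) (y | y) hxy
    · simp only [Sum.elim_inl] at hxy
      obtain ⟨a, x, rfl⟩ := indMk_surj x
      obtain ⟨y, rfl, hy⟩ := exists_of_indMap_eq i hxy.symm
      have := h.1 (a₁ := Sum.inl x) (a₂ := Sum.inl y) hy.symm
      rw [Sum.inl.inj this]
    · simp only [Sum.elim_inl, Sum.elim_inr] at hxy
      obtain ⟨a, x, rfl⟩ := indMk_surj x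
      obtain ⟨y, rfl, hy⟩ := exists_of_indMap_eq j hxy.symm
      cases h.1 (a₁ := Sum.inl x) (a₂ := Sum.inr y) hy.symm
    · simp only [Sum.elim_inl, Sum.elim_inr] at hxy
      obtain ⟨a, x, rfl⟩ := indMk_surj x
      obtain ⟨y, rfl, hy⟩ := exists_of_indMap_eq i hxy.symm
      cases h.1 (a₁ := Sum.inr x) (a₂ := Sum.inl y) hy.symm
    · simp only [Sum.elim_inr] at hxy
      obtain ⟨a, x, rfl⟩ := indMk_surj x
      obtain ⟨y, rfl, hy⟩ := exists_of_indMap_eq j hxy.symm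
      have := h.1 (a₁ := Sum.inr x) (a₂ := Sum.inr y) hy.symm
      rw [Sum.inr.inj this]
  · intro z
    obtain ⟨a, z, rfl⟩ := indMk_surj z
    obtain ⟨x | x, rfl⟩ := h.2 z
    · exact ⟨Sum.inl (indMk a x), rfl⟩
    · exact ⟨Sum.inr (indMk a x), rfl⟩

theorem indMap_isCartesian {W X Y Z : FinGSet H} (p : W →[H] X) (q : W →[H] Y)
    (f : X →[H] Z) (g : Y →[H] Z) (h : IsCartesian p q f g) :
    IsCartesian (indMap p) (indMap q) (indMap f) (indMap g) := by
  constructor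
  · intro w
    obtain ⟨a, w, rfl⟩ := indMk_surj w
    simp only [indMap_mk, h.1 w]
  · intro x y hxy
    obtain ⟨a, x, rfl⟩ := indMk_surj x
    obtain ⟨y, rfl, hy⟩ := exists_of_indMap_eq g hxy.symm
    obtain ⟨w, ⟨hwx, hwy⟩, huniq⟩ := h.2 x y hy.symm
    refine ⟨indMk a w, ⟨by rw [indMap_mk, hwx], by rw [indMap_mk, hwy]⟩, ?_⟩
    rintro w' ⟨h₁, h₂⟩
    obtain ⟨w', rfl, hw'⟩ := exists_of_indMap_eq p h₁
    rw [huniq w' ⟨hw', indMk_inj h₂⟩]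

theorem indMap_isExponential {A X Y B P : FinGSet H} (f : A →[H] X) (g : X →[H] Y)
    (h : B →[H] Y) (p : P →[H] X) (q : P →[H] B) (e : P →[H] A)
    (hE : IsExponential f g h p q e) :
    IsExponential (indMap f) (indMap g) (indMap h) (indMap p) (indMap q) (indMap e) := by
  obtain ⟨hC, hfe, hs⟩ := hE
  refine ⟨indMap_isCartesian _ _ _ _ hC, ?_, ?_⟩
  · intro r
    obtain ⟨a, r, rfl⟩ := indMk_surj r
    simp only [indMap_mk, hfe r]
  · intro y s hsec
    obtain ⟨a, y, rfl⟩ := indMk_surj y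
    have key : ∀ x : {x : X // g x = y}, ∃ c : A,
        indMk a c = s ⟨indMk a x.1, by rw [indMap_mk, x.2]⟩ ∧ f c = x := fun x =>
      exists_of_indMap_eq f (hsec ⟨indMk a x.1, by rw [indMap_mk, x.2]⟩)
    choose t ht hft using key
    obtain ⟨b, ⟨hb, hbe⟩, huniq⟩ := hs y t hft
    refine ⟨indMk a b, ⟨by rw [indMap_mk, hb], ?_⟩, ?_⟩
    · rintro ⟨x, hx⟩ r rfl hr
      obtain ⟨r, rfl, hrb⟩ := exists_of_indMap_eq q hr
      have hgp : g (p r) = y := by rw [hC.1 r, hrb, hb]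
      rw [indMap_mk, hbe ⟨p r, hgp⟩ r rfl hrb, ht]
      rfl
    · rintro b' ⟨hb', hbe'⟩
      obtain ⟨b', rfl, hb'y⟩ := exists_of_indMap_eq h hb'
      rw [huniq b' ⟨hb'y, ?_⟩]
      rintro x r hpr hqr
      have := hbe' ⟨indMk a x.1, by rw [indMap_mk, x.2]⟩ (indMk a r)
        (by rw [indMap_mk, hpr]) (by rw [indMap_mk, hqr])
      rw [← ht, indMap_mk] at this
      exact indMk_inj this

end FinGSet

/-- Induction `X ↦ G ×_H X` of finite sets with group action from `H` to `G`. -/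
def GSetFunctor.induction : GSetFunctor H G where
  obj := FinGSet.ind H
  map := FinGSet.indMap
  map_id X := MulActionHom.ext fun z => by
    obtain ⟨a, x, rfl⟩ := FinGSet.indMk_surj z
    rfl
  map_comp g f := MulActionHom.ext fun z => by
    obtain ⟨a, x, rfl⟩ := FinGSet.indMk_surj z
    rfl
  isEmpty X hX := ⟨fun z => by
    obtain ⟨a, x, rfl⟩ := FinGSet.indMk_surj z
    exact hX.elim x⟩
  isDisjointUnion := FinGSet.indMap_isDisjointUnion
  isCartesian := FinGSet.indMap_isCartesian
  isExponential := FinGSet.indMap_isExponential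

/-- The restriction of a `G`-Tambara functor to the subgroup `H`, with value `k(G ×_H X)` at the
finite `H`-set `X`; in particular its value at `H/L` is `k(G/L)`. -/
def TambaraFunctor.restrict (k : TambaraFunctor.{u} G) : TambaraFunctor.{u} H :=
  k.precomp (GSetFunctor.induction H)

end Induction

/-! ## Gluing data -/

section Gluing

variable {G : Type} [Group G] [Finite G] (N : Subgroup G) [N.Normal]

/-- A `G/N`-Tambara functor `top`, a `G`-ring `field`, an `N`-Tambara functor `bot`, and
identifications `top((G/N)/e) ≅ bot(N/N)` and `bot(N/e) ≅ field` of rings. -/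
structure GluingData where
  top : TambaraFunctor.{u} (G ⧸ N)
  field : Type u
  [commRing : CommRing field]
  [action : MulSemiringAction G field]
  bot : TambaraFunctor.{u} N
  topIso : top.bottom ≃+* bot.topLevel
  botIso : bot.bottom ≃+* field

attribute [instance] GluingData.commRing GluingData.action

variable {N}

/-- The ring map `top((G/N)/e) ≅ bot(N/N) → bot(N/e) ≅ field`. -/
def GluingData.connectingMap (D : GluingData.{u} N) : D.top.bottom →+* D.field :=
  (D.botIso : D.bot.bottom →+* D.field).comp
    (D.bot.resTopBottom.comp (D.topIso : D.top.bottom →+* D.bot.topLevel))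

/-- The compatible triples: `top` and `bot` are clarified Tambara fields of characteristic `p`,
`field` is a field, the identification of `bot(N/e)` with `field` is `N`-equivariant, and the ring
map `top((G/N)/e) → field` is equivariant, where `G` acts on its source through `G/N`. -/
structure GluingData.IsCompatible (p : ℕ) (D : GluingData.{u} N) : Prop where
  top_clarified : D.top.IsClarifiedOfChar p
  isField : IsField D.field
  bot_clarified : D.bot.IsClarifiedOfChar p
  botIso_smul : ∀ (h : N) (a : D.bot.bottom), D.botIso (h • a) = (h : G) • D.botIso a
  connectingMap_smul : ∀ (g : G) (a : D.top.bottom),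
    D.connectingMap ((g : G ⧸ N) • a) = g • D.connectingMap a

/-- Isomorphisms of triples. -/
structure GluingData.Iso (D D' : GluingData.{u} N) where
  top : D.top ≅ D'.top
  field : D.field ≃+* D'.field
  bot : D.bot ≅ D'.bot
  field_smul : ∀ (g : G) (a : D.field), field (g • a) = g • field a
  topIso_comm : ∀ a : D.top.bottom, D'.topIso (top.hom.app _ a) = bot.hom.app _ (D.topIso a)
  botIso_comm : ∀ a : D.bot.bottom, D'.botIso (bot.hom.app _ a) = field (D.botIso a)

variable (N)

/-- The map `G ×_N (N/N) → G/N` of `G`-sets, `[g, *] ↦ gN`. -/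
def FinGSet.indPointToQuotient :
    FinGSet.ind N (FinGSet.point N) →[G] FinGSet.inflate N (FinGSet.free (G ⧸ N)) where
  toFun := Quotient.lift (fun a => (a.1 : G ⧸ N)) (by
    rintro ⟨a, x⟩ ⟨b, y⟩ ⟨h, h₁, -⟩
    simp only at h₁
    subst h₁
    exact QuotientGroup.mk_mul_of_mem b h.2)
  map_smul' := by
    rintro g ⟨a, x⟩
    rfl

/-- The inverse map `G/N → G ×_N (N/N)`, `gN ↦ [g, *]`. -/
def FinGSet.quotientToIndPoint :
    FinGSet.inflate N (FinGSet.free (G ⧸ N)) →[G] FinGSet.ind N (FinGSet.point N) where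
  toFun := Quotient.lift (fun g : G => FinGSet.indMk g (PUnit.unit : FinGSet.point N)) (by
    intro a b hab
    have hab' : a⁻¹ * b ∈ N := QuotientGroup.leftRel_apply.1 hab
    exact FinGSet.indMk_eq_iff.2 ⟨⟨a⁻¹ * b, hab'⟩⁻¹, by simp, rfl⟩)
  map_smul' := by
    rintro g ⟨a⟩
    rfl

/-- The map `G/e → G ×_N (N/e)` of `G`-sets, `g ↦ [g, 1]`. -/
def FinGSet.freeToIndFree : FinGSet.free G →[G] FinGSet.ind N (FinGSet.free N) where
  toFun g := FinGSet.indMk g (1 : N)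
  map_smul' _ _ := rfl

/-- The inverse map `G ×_N (N/e) → G/e`, `[g, x] ↦ g * x`. -/
def FinGSet.indFreeToFree : FinGSet.ind N (FinGSet.free N) →[G] FinGSet.free G where
  toFun := Quotient.lift (fun a : G × N => a.1 * (a.2 : G)) (by
    rintro ⟨a, x⟩ ⟨b, y⟩ ⟨h, h₁, h₂⟩
    simp only at h₁ h₂
    subst h₁ h₂
    simp [mul_assoc])
  map_smul' := by
    rintro g ⟨a, x⟩
    exact mul_assoc g a (x : G)

/-- The triple obtained from a `G`-Tambara functor `k`: its top piece, the `G`-ring `k(G/e)` and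
its restriction to `N`, with the identifications given by the isomorphisms of `G`-sets
`G ×_N (N/N) ≅ G/N` and `G ×_N (N/e) ≅ G/e`. -/
def TambaraFunctor.decompose (k : TambaraFunctor.{u} G) : GluingData.{u} N where
  top := k.topPiece N
  field := k.bottom
  bot := k.restrict N
  topIso := k.resEquiv (FinGSet.indPointToQuotient N) (FinGSet.quotientToIndPoint N)
    (by rintro ⟨a, x⟩; rfl) (by rintro ⟨a⟩; rfl)
  botIso := k.resEquiv (FinGSet.freeToIndFree N) (FinGSet.indFreeToFree N)
    (fun x => mul_one x) (by
      intro z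
      obtain ⟨a, x, rfl⟩ := FinGSet.indMk_surj z
      exact FinGSet.indMk_eq_iff.2 ⟨x, rfl, mul_one x⟩)

variable {N}

/-- The isomorphism `φ` of triples is the one induced by the isomorphism `ψ` of Tambara
functors. -/
def GluingData.Iso.IsInducedBy {k k' : TambaraFunctor.{u} G}
    (φ : GluingData.Iso (k.decompose N) (k'.decompose N)) (ψ : k ≅ k') : Prop :=
  (∀ (X : FinGSet (G ⧸ N)) (a : k.obj (FinGSet.inflate N X)),
      φ.top.hom.app X a = ψ.hom.app (FinGSet.inflate N X) a) ∧
    (∀ a : k.bottom, φ.field a = ψ.hom.app (FinGSet.free G) a) ∧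
    ∀ (X : FinGSet N) (a : k.obj (FinGSet.ind N X)),
      φ.bot.hom.app X a = ψ.hom.app (FinGSet.ind N X) a

end Gluing

/-- The Tambara functors for cyclic `p`-groups which are obtained from clarified Tambara fields of
characteristic `p` for groups of order `p` by iterated gluing along compatible triples. -/
inductive IsIteratedGluing (p : ℕ) :
    ∀ (G : Type) [CommGroup G] [Finite G], TambaraFunctor.{u} G → Prop
  | base (G : Type) [CommGroup G] [Finite G] (hG : Nat.card G = p)
      (k : TambaraFunctor.{u} G) (hk : k.IsClarifiedOfChar p) : IsIteratedGluing p G k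
  | glue (G : Type) [CommGroup G] [Finite G] [IsCyclic G] (N : Subgroup G) (hN : Nat.card N = p)
      (D : GluingData.{u} N) (hD : D.IsCompatible p) (htop : IsIteratedGluing p (G ⧸ N) D.top)
      (k : TambaraFunctor.{u} G) (hk : Nonempty (GluingData.Iso (k.decompose N) D)) :
      IsIteratedGluing p G k

/-!
A clarified Tambara field `k` is the same thing as a field `F = k(G/e)` with an action of `G`
together with a subfunctor of its fixed point functor `X ↦ Map_G(X, F)` which is everything at `G/e`
(`TambaraFunctor.isClarified_iff`). Indeed, `k` maps to the fixed point functor of `k(G/e)`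
(`evalHom`), and to that of every quotient of `k(G/e)` by a stable ideal; field-likeness makes these
maps injective, so there are no nontrivial stable ideals, and by the Chinese remainder theorem
`k(G/e)` is coinduced from the residue field of a maximal ideal, the subgroup being its stabilizer
(`isField_or_exists_equiv_coindRing`). As `k` is clarified, this subgroup is `G`, and the maximal
ideal is stable, hence zero. Conversely, a ring coinduced from a proper subgroup has nontrivial
idempotents, and a morphism from such a subfunctor to a nonzero Tambara functor is injective on the
field `k(G/e)`, hence everywhere.

In this description transfers and norms are sums and products over fibres (`eval_tr`, `eval_nm`),
and whether an equivariant function belongs to `k(X)` can be decided one point of `X` at a time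
(`exists_forall_eval_eq`). In a cyclic `p`-group every subgroup is trivial or contains the subgroup
`N` of order `p` (`eq_bot_or_le_of_card_eq_prime`). At a point with trivial stabilizer every value
in `F` is allowed, and at a point fixed by `N` the allowed values are governed by the top piece.
Hence:

* An isomorphism of triples maps the allowed values at each point to the allowed values, so it
  lifts, uniquely, to the Tambara functors (`GluingData.Iso.existsUnique_isInducedBy`). In the
  same way the bottom piece of a triple is determined by the image of `bot(N/N)` in `F`
  (`GluingData.exists_iso`).
* A compatible triple is glued to the functor of those `f : X → F` whose restriction to the
  `N`-fixed points of `X` comes from the top piece (`GluingData.glue`). This is stable under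
  transfers and norms: splitting off free orbits (`fiberProd_mem`) leaves maps between `N`-fixed
  sets, where the top piece is stable, and the projection `G/e → G/N`, where the required elements
  of `top((G/N)/e) ≅ bot(N/N)` are the transfers and norms of the bottom piece.
* For a Tambara functor whose triple is isomorphic to a compatible one, elements are determined by
  their values at points (`TambaraFunctor.isFaithful_of_topPiece`), so it is a clarified Tambara
  field. The recursive description follows by induction on the order of the group.
-/

/-! ### Products and sums over the fibres of a map -/

section FiberProd

variable {W X Y Z A B P : Type} {M M' : Type*} [CommMonoid M] [CommMonoid M']

open Classical in
/-- The product `∏ a x` over the points `x` of the finite set `X` with `f x = y`. -/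
@[to_additive /-- The sum `∑ a x` over the points `x` of the finite set `X` with `f x = y`. -/]
noncomputable def fiberProd [Finite X] (f : X → Y) (a : X → M) (y : Y) : M :=
  letI := Fintype.ofFinite X
  ∏ x with f x = y, a x

@[to_additive]
theorem fiberProd_def [Fintype X] [DecidableEq Y] (f : X → Y) (a : X → M) (y : Y) :
    fiberProd f a y = ∏ x with f x = y, a x := by
  unfold fiberProd
  congr!

@[to_additive]
theorem fiberProd_id [Finite X] (a : X → M) (x : X) : fiberProd (fun x => x) a x = a x := by
  classical
  have := Fintype.ofFinite X
  rw [fiberProd_def, Finset.filter_eq' Finset.univ x]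
  simp

@[to_additive]
theorem fiberProd_comp [Finite X] [Finite Y] (g : Y → Z) (f : X → Y) (a : X → M) (z : Z) :
    fiberProd (fun x => g (f x)) a z = fiberProd g (fiberProd f a) z := by
  classical
  have := Fintype.ofFinite X
  have := Fintype.ofFinite Y
  simp only [fiberProd_def]
  rw [← Finset.prod_fiberwise_of_maps_to (t := Finset.univ.filter fun y => g y = z) (g := f)
    (by simp)]
  refine Finset.prod_congr rfl fun y hy => Finset.prod_congr ?_ fun _ _ => rfl
  ext x
  simp only [Finset.mem_filter, Finset.mem_univ, true_and] at hy ⊢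
  constructor
  · rintro ⟨-, h⟩; exact h
  · rintro rfl; exact ⟨hy, rfl⟩

@[to_additive]
theorem fiberProd_of_cartesian [Finite X] [Finite W] (p : W → X) (q : W → Y) (f : X → Z)
    (g : Y → Z) (h : (∀ w, f (p w) = g (q w)) ∧ ∀ x y, f x = g y → ∃! w, p w = x ∧ q w = y)
    (a : X → M) (y : Y) : fiberProd f a (g y) = fiberProd q (fun w => a (p w)) y := by
  classical
  have := Fintype.ofFinite X
  have := Fintype.ofFinite W
  simp only [fiberProd_def]
  symm
  refine Finset.prod_bij (fun w _ => p w) ?_ ?_ ?_ fun _ _ => rfl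
  · intro w hw
    simp only [Finset.mem_filter, Finset.mem_univ, true_and] at hw ⊢
    rw [h.1, hw]
  · intro w hw w' hw' hp
    simp only [Finset.mem_filter, Finset.mem_univ, true_and] at hw hw'
    exact (h.2 (p w) y (by rw [h.1, hw])).unique ⟨rfl, hw⟩ ⟨hp.symm, hw'⟩
  · intro x hx
    simp only [Finset.mem_filter, Finset.mem_univ, true_and] at hx
    obtain ⟨w, ⟨h₁, h₂⟩, -⟩ := h.2 x y hx
    exact ⟨w, by simpa using h₂, h₁⟩

@[to_additive]
theorem fiberProd_of_disjointUnion [Finite X] [Finite Y] [Finite Z] (i : X → Z) (j : Y → Z)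
    (h : Function.Bijective (Sum.elim i j : X ⊕ Y → Z)) (f : Z → W) (a : Z → M) (w : W) :
    fiberProd f a w = fiberProd (fun x => f (i x)) (fun x => a (i x)) w *
      fiberProd (fun y => f (j y)) (fun y => a (j y)) w := by
  classical
  have := Fintype.ofFinite X
  have := Fintype.ofFinite Y
  have := Fintype.ofFinite Z
  simp only [fiberProd_def, Finset.prod_filter]
  rw [← h.prod_comp, Fintype.prod_sum_type]
  rfl

@[to_additive]
theorem map_fiberProd [Finite X] (φ : M →* M') (f : X → Y) (a : X → M) (y : Y) :
    φ (fiberProd f a y) = fiberProd f (fun x => φ (a x)) y := by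
  classical
  have := Fintype.ofFinite X
  simp only [fiberProd_def, map_prod]

@[to_additive]
theorem fiberProd_one [Finite X] (f : X → Y) (y : Y) : fiberProd f (fun _ => (1 : M)) y = 1 := by
  classical
  have := Fintype.ofFinite X
  simp [fiberProd_def]

@[to_additive]
theorem fiberProd_mul [Finite X] (f : X → Y) (a b : X → M) (y : Y) :
    fiberProd f (fun x => a x * b x) y = fiberProd f a y * fiberProd f b y := by
  classical
  have := Fintype.ofFinite X
  simp [fiberProd_def, Finset.prod_mul_distrib]

@[to_additive]
theorem fiberProd_congr [Finite X] (f : X → Y) {a b : X → M} {y : Y}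
    (h : ∀ x, f x = y → a x = b x) : fiberProd f a y = fiberProd f b y := by
  classical
  have := Fintype.ofFinite X
  simp only [fiberProd_def]
  exact Finset.prod_congr rfl fun x hx => h x (by simpa using hx)

@[to_additive]
theorem fiberProd_of_forall_ne [Finite X] (f : X → Y) (a : X → M) {y : Y} (h : ∀ x, f x ≠ y) :
    fiberProd f a y = 1 := by
  rw [fiberProd_congr f (b := fun _ => 1) fun x hx => absurd hx (h x), fiberProd_one]

/-- The distributive law: a product of sums along the fibres of `g` is a sum over the sections
of `f` over these fibres. -/
theorem fiberProd_fiberSum {R : Type*} [CommSemiring R] [Finite A] [Finite X] [Finite B] [Finite P]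
    (f : A → X) (g : X → Y) (h : B → Y) (p : P → X) (q : P → B) (e : P → A)
    (hc : (∀ r, g (p r) = h (q r)) ∧ ∀ x b, g x = h b → ∃! r, p r = x ∧ q r = b)
    (he : ∀ r, f (e r) = p r)
    (hs : ∀ (y : Y) (s : {x : X // g x = y} → A), (∀ x, f (s x) = x) →
      ∃! b : B, h b = y ∧ ∀ (x : {x : X // g x = y}) (r : P), p r = x → q r = b → e r = s x)
    (a : A → R) (y : Y) :
    fiberProd g (fiberSum f a) y = fiberSum h (fiberProd q fun r => a (e r)) y := by
  classical
  have := Fintype.ofFinite X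
  have := Fintype.ofFinite A
  have := Fintype.ofFinite B
  have := Fintype.ofFinite P
  simp only [fiberProd_def, fiberSum_def]
  rw [← Finset.prod_subtype_eq_prod_filter, Finset.subtype_univ,
    Finset.prod_univ_sum]
  have key : ∀ s ∈ Fintype.piFinset (fun x : {x // g x = y} => Finset.univ.filter (f · = x.1)),
      ∀ x, f (s x) = x := by
    intro s hs x
    simpa using Fintype.mem_piFinset.1 hs x
  refine Finset.sum_bij (fun s hs' => (hs y s (key s hs')).choose) ?_ ?_ ?_ ?_
  · intro s hs'
    simpa using (hs y s (key s hs')).choose_spec.1.1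
  · intro s hs₁ t ht heq
    have h₁ := (hs y s (key s hs₁)).choose_spec.1
    have h₂ := (hs y t (key t ht)).choose_spec.1
    rw [← heq] at h₂
    ext x
    obtain ⟨r, ⟨hr₁, hr₂⟩, -⟩ := hc.2 x _ (x.2.trans h₁.1.symm)
    rw [← h₁.2 x r hr₁ hr₂, ← h₂.2 x r hr₁ hr₂]
  · intro b hb
    have hb' : h b = y := by simpa using hb
    choose r hr _ using fun x : {x // g x = y} => hc.2 x b (x.2.trans hb'.symm)
    have hmem : (fun x => e (r x)) ∈
        Fintype.piFinset (fun x : {x // g x = y} => Finset.univ.filter (f · = x.1)) :=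
      Fintype.mem_piFinset.2 fun x => by simp [he, (hr x).1]
    refine ⟨_, hmem, ?_⟩
    have h₁ := (hs y _ (key _ hmem)).choose_spec
    refine (h₁.2 b ⟨hb', fun x t ht₁ ht₂ => ?_⟩).symm
    exact congrArg e ((hc.2 x b (x.2.trans hb'.symm)).unique ⟨ht₁, ht₂⟩ (hr x))
  · intro s hs'
    obtain ⟨h₁, h₂⟩ := (hs y s (key s hs')).choose_spec.1
    set b := (hs y s (key s hs')).choose
    symm
    refine Finset.prod_bij (fun r hr => ⟨p r, ?_⟩) ?_ ?_ ?_ ?_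
    · rw [hc.1, (Finset.mem_filter.1 hr).2, h₁]
    · simp
    · intro r hr t ht hrt
      have hr' := (Finset.mem_filter.1 hr).2
      have ht' := (Finset.mem_filter.1 ht).2
      exact (hc.2 (p r) b (by rw [hc.1, hr'])).unique ⟨rfl, hr'⟩
        ⟨(congrArg Subtype.val hrt).symm, ht'⟩
    · intro x _
      obtain ⟨r, ⟨hr₁, hr₂⟩, -⟩ := hc.2 x b (x.2.trans h₁.symm)
      exact ⟨r, by simpa using hr₂, Subtype.ext hr₁⟩
    · intro r hr
      rw [h₂ ⟨p r, _⟩ r rfl (Finset.mem_filter.1 hr).2]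

end FiberProd

/-! ### The fixed point functor of a `G`-ring -/

section FixedFunctor

variable {G : Type} [Group G]

theorem fiberProd_smul {X Y : FinGSet G} {M : Type*} [CommMonoid M] [MulDistribMulAction G M]
    (f : X →[G] Y) (a : X → M) (ha : ∀ (g : G) x, a (g • x) = g • a x) (g : G) (y : Y) :
    fiberProd f a (g • y) = g • fiberProd f a y := by
  change _ = MulDistribMulAction.toMonoidHom M g _
  rw [map_fiberProd, fiberProd_of_cartesian (fun x : X => g • x) (fun x : X => f x) f
    (fun y : Y => g • y)]
  · simp only [ha]; rfl
  · refine ⟨fun x => map_smul f g x, fun x y h => ⟨g⁻¹ • x, ⟨smul_inv_smul g x, ?_⟩, ?_⟩⟩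
    · simp only [map_smul, h, inv_smul_smul]
    · rintro x' ⟨rfl, -⟩; simp

theorem fiberSum_smul {X Y : FinGSet G} {M : Type*} [AddCommMonoid M] [DistribMulAction G M]
    (f : X →[G] Y) (a : X → M) (ha : ∀ (g : G) x, a (g • x) = g • a x) (g : G) (y : Y) :
    fiberSum f a (g • y) = g • fiberSum f a y := by
  change _ = DistribSMul.toAddMonoidHom M g _
  rw [map_fiberSum, fiberSum_of_cartesian (fun x : X => g • x) (fun x : X => f x) f
    (fun y : Y => g • y)]
  · simp only [ha]; rfl
  · refine ⟨fun x => map_smul f g x, fun x y h => ⟨g⁻¹ • x, ⟨smul_inv_smul g x, ?_⟩, ?_⟩⟩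
    · simp only [map_smul, h, inv_smul_smul]
    · rintro x' ⟨rfl, -⟩; simp

variable (R : Type u) [CommRing R] [MulSemiringAction G R]

/-- The ring of equivariant functions `X → R`. -/
def equivariantFunctions (X : FinGSet G) : Subring (X → R) where
  carrier := {a | ∀ (g : G) (x : X), a (g • x) = g • a x}
  mul_mem' ha hb g x := by simp [ha g x, hb g x]
  one_mem' g x := by simp
  add_mem' ha hb g x := by simp [ha g x, hb g x]
  zero_mem' g x := by simp
  neg_mem' ha g x := by simp [ha g x]

/-- The fixed point Tambara functor of the `G`-ring `R`: its value at `X` is the ring of equivariant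
functions `X → R`, so its value at `G/H` is the ring of fixed points of `H` on `R`. Transfers and
norms are sums and products over fibres. -/
noncomputable def fixedFunctor : TambaraFunctor.{u} G where
  obj X := equivariantFunctions R X
  res {X Y} f :=
    { toFun := fun a => ⟨fun x => a.1 (f x), fun g x => by
        simpa only [map_smul] using a.2 g (f x)⟩
      map_one' := rfl
      map_mul' := fun _ _ => rfl
      map_zero' := rfl
      map_add' := fun _ _ => rfl }
  tr {X Y} f :=
    { toFun := fun a => ⟨fiberSum f a.1, fiberSum_smul f a.1 a.2⟩
      map_zero' := Subtype.ext (funext fun y => fiberSum_zero f y)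
      map_add' := fun a b => Subtype.ext (funext fun y => fiberSum_add f a.1 b.1 y) }
  nm {X Y} f :=
    { toFun := fun a => ⟨fiberProd f a.1, fiberProd_smul f a.1 a.2⟩
      map_one' := Subtype.ext (funext fun y => fiberProd_one f y)
      map_mul' := fun a b => Subtype.ext (funext fun y => fiberProd_mul f a.1 b.1 y) }
  res_id X a := rfl
  tr_id X a := Subtype.ext (funext fun x => fiberSum_id a.1 x)
  nm_id X a := Subtype.ext (funext fun x => fiberProd_id a.1 x)
  res_comp g f a := rfl
  tr_comp g f a := Subtype.ext (funext fun x => fiberSum_comp g f a.1 x)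
  nm_comp g f a := Subtype.ext (funext fun x => fiberProd_comp g f a.1 x)
  subsingleton_of_isEmpty X hX := ⟨fun a b => Subtype.ext (funext fun x => hX.elim x)⟩
  bijective_of_isDisjointUnion {X Y Z} i j h := by
    constructor
    · intro a b hab
      obtain ⟨h₁, h₂⟩ := Prod.ext_iff.1 hab
      refine Subtype.ext (funext fun z => ?_)
      obtain ⟨x | y, rfl⟩ := h.2 z
      · exact congrFun (congrArg Subtype.val h₁) x
      · exact congrFun (congrArg Subtype.val h₂) y
    · rintro ⟨a, b⟩
      let e := Equiv.ofBijective _ h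
      have hi : ∀ x, e.symm (i x) = Sum.inl x := fun x => e.symm_apply_apply (Sum.inl x)
      have hj : ∀ x, e.symm (j x) = Sum.inr x := fun x => e.symm_apply_apply (Sum.inr x)
      refine ⟨⟨fun z => Sum.elim a.1 b.1 (e.symm z), fun g z => ?_⟩, ?_⟩
      · obtain ⟨x | y, rfl⟩ := h.2 z
        · simpa only [Sum.elim_inl, ← map_smul, hi] using a.2 g x
        · simpa only [Sum.elim_inr, ← map_smul, hj] using b.2 g y
      · refine Prod.ext (Subtype.ext (funext fun x => ?_)) (Subtype.ext (funext fun x => ?_))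
        · exact congrArg (Sum.elim a.1 b.1) (hi x)
        · exact congrArg (Sum.elim a.1 b.1) (hj x)
  res_tr p q f g h a := Subtype.ext (funext fun y => fiberSum_of_cartesian p q f g h a.1 y)
  res_nm p q f g h a := Subtype.ext (funext fun y => fiberProd_of_cartesian p q f g h a.1 y)
  nm_tr f g h p q e he a := Subtype.ext (funext fun y =>
    fiberProd_fiberSum f g h p q e he.1 he.2.1 he.2.2 a.1 y)

end FixedFunctor

/-! ### Sub-`G`-sets -/

namespace FinGSet

variable {G : Type} [Group G]

/-- A `G`-stable subset of a finite `G`-set. -/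
abbrev sub (X : FinGSet G) (s : SubMulAction G X) : FinGSet G where
  carrier := s

/-- The inclusion of a `G`-stable subset. -/
def incl {X : FinGSet G} (s : SubMulAction G X) : sub X s →[G] X := s.subtype

/-- The orbit of a point. -/
def orbitOf {X : FinGSet G} (x : X) : SubMulAction G X where
  carrier := MulAction.orbit G x
  smul_mem' g _ hy := MulAction.mem_orbit_of_mem_orbit g hy

theorem isDisjointUnion_incl_compl {X : FinGSet G} (s : SubMulAction G X) :
    IsDisjointUnion (incl s) (incl sᶜ) := by
  constructor
  · rintro (x | x) (y | y) h
    · exact congrArg _ (Subtype.ext h)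
    · exact absurd (show x.1 ∈ s from x.2) (by rw [show x.1 = y.1 from h]; exact y.2)
    · exact absurd (show y.1 ∈ s from y.2) (by rw [← show x.1 = y.1 from h]; exact x.2)
    · exact congrArg _ (Subtype.ext h)
  · intro x
    by_cases hx : x ∈ s
    · exact ⟨Sum.inl ⟨x, hx⟩, rfl⟩
    · exact ⟨Sum.inr ⟨x, hx⟩, rfl⟩

/-- The map `G/e → X` given by a point of `X`. -/
def orbitMap [Finite G] {X : FinGSet G} (x : X) : free G →[G] X where
  toFun g := g • x
  map_smul' a g := mul_smul a g x

theorem comp_orbitMap [Finite G] {X Y : FinGSet G} (f : X →[G] Y) (x : X) :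
    f.comp (orbitMap x) = orbitMap (f x) :=
  MulActionHom.ext fun g : G => map_smul f g x

theorem orbitMap_smul [Finite G] {X : FinGSet G} (g : G) (x : X) :
    orbitMap (g • x) = (orbitMap x).comp (rightMul g) :=
  MulActionHom.ext fun a : G => (mul_smul a g x).symm

theorem orbitMap_injective [Finite G] {X : FinGSet G} {x : X}
    (h : MulAction.stabilizer G x = ⊥) : Function.Injective (orbitMap x) := by
  intro (a : G) (b : G) hab
  have : b⁻¹ * a ∈ MulAction.stabilizer G x := by
    rw [MulAction.mem_stabilizer_iff, mul_smul, inv_smul_eq_iff]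
    exact hab
  rw [h, Subgroup.mem_bot] at this
  exact (inv_mul_eq_one.1 this).symm

/-- A free orbit and its complement. -/
theorem isDisjointUnion_orbitMap [Finite G] {X : FinGSet G} {x : X}
    (h : MulAction.stabilizer G x = ⊥) : IsDisjointUnion (orbitMap x) (incl (orbitOf x)ᶜ) := by
  constructor
  · rintro (a | y) (b | z) hab
    · exact congrArg _ (orbitMap_injective h hab)
    · exact absurd ⟨a, hab⟩ z.2
    · exact absurd ⟨b, hab.symm⟩ y.2
    · exact congrArg _ (Subtype.ext hab)
  · intro y
    by_cases hy : y ∈ orbitOf x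
    · obtain ⟨g, rfl⟩ := hy
      exact ⟨Sum.inl g, rfl⟩
    · exact ⟨Sum.inr ⟨y, hy⟩, rfl⟩

/-- The product of a set with trivial action and a `G`-set. -/
def copies (T : Type) [Finite T] (X : FinGSet G) : FinGSet G where
  carrier := T × X
  mulAction :=
    { smul := fun g a => (a.1, g • a.2)
      one_smul := fun a => Prod.ext rfl (one_smul G a.2)
      mul_smul := fun g h a => Prod.ext rfl (mul_smul g h a.2) }

/-- The inclusion of a summand of `T × X`. -/
def copiesIncl {T : Type} [Finite T] (X : FinGSet G) (t : T) : X →[G] copies T X where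
  toFun x := (t, x)
  map_smul' _ _ := rfl

/-- The projection `T × X → X`, the identity on each summand. -/
def fold (T : Type) [Finite T] (X : FinGSet G) : copies T X →[G] X where
  toFun a := a.2
  map_smul' _ _ := rfl

/-- The map `T × X → T' × X` given by a map `T → T'`. -/
def copiesMap {T T' : Type} [Finite T] [Finite T'] (f : T → T') (X : FinGSet G) :
    copies T X →[G] copies T' X where
  toFun a := (f a.1, a.2)
  map_smul' _ _ := rfl

/-- The empty `G`-set. -/
def empty (G : Type) [Group G] : FinGSet G where
  carrier := PEmpty
  mulAction :=
    { smul := fun _ x => x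
      one_smul := fun _ => rfl
      mul_smul := fun _ _ _ => rfl }

/-- The map from the empty `G`-set. -/
def fromEmpty (X : FinGSet G) : empty G →[G] X where
  toFun x := x.elim
  map_smul' _ x := x.elim

end FinGSet

/-! ### Disjoint unions -/

namespace TambaraFunctor

open FinGSet

section Basic

variable {G : Type} [Group G] (k : TambaraFunctor.{u} G)

theorem res_comp_eq {X Y Z : FinGSet G} {g : Y →[G] Z} {f : X →[G] Y} {h : X →[G] Z}
    (e : g.comp f = h) (a : k.obj Z) : k.res f (k.res g a) = k.res h a := by
  rw [← e, k.res_comp]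

theorem tr_comp_eq {X Y Z : FinGSet G} {g : Y →[G] Z} {f : X →[G] Y} {h : X →[G] Z}
    (e : g.comp f = h) (a : k.obj X) : k.tr g (k.tr f a) = k.tr h a := by
  rw [← e, k.tr_comp]

theorem nm_comp_eq {X Y Z : FinGSet G} {g : Y →[G] Z} {f : X →[G] Y} {h : X →[G] Z}
    (e : g.comp f = h) (a : k.obj X) : k.nm g (k.nm f a) = k.nm h a := by
  rw [← e, k.nm_comp]

theorem isCartesian_id_of_injective {X Z : FinGSet G} {i : X →[G] Z} (hi : Function.Injective i) :
    IsCartesian (MulActionHom.id G) (MulActionHom.id G) i i :=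
  ⟨fun _ => rfl, fun x _ h => ⟨x, ⟨rfl, hi h⟩, fun _ h => h.1⟩⟩

theorem res_tr_of_injective {X Z : FinGSet G} {i : X →[G] Z} (hi : Function.Injective i)
    (a : k.obj X) : k.res i (k.tr i a) = a := by
  rw [k.res_tr _ _ _ _ (isCartesian_id_of_injective hi), k.res_id, k.tr_id]

theorem res_nm_of_injective {X Z : FinGSet G} {i : X →[G] Z} (hi : Function.Injective i)
    (a : k.obj X) : k.res i (k.nm i a) = a := by
  rw [k.res_nm _ _ _ _ (isCartesian_id_of_injective hi), k.res_id, k.nm_id]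

instance : Subsingleton (k.obj (empty G)) := k.subsingleton_of_isEmpty _ PEmpty.instIsEmpty

theorem isCartesian_fromEmpty {X Y Z : FinGSet G} {i : X →[G] Z} {j : Y →[G] Z}
    (h : ∀ x y, i x ≠ j y) : IsCartesian (fromEmpty X) (fromEmpty Y) i j :=
  ⟨fun w => w.elim, fun x y hxy => absurd hxy (h x y)⟩

theorem res_tr_of_disjoint {X Y Z : FinGSet G} {i : X →[G] Z} {j : Y →[G] Z}
    (h : ∀ x y, i x ≠ j y) (a : k.obj X) : k.res j (k.tr i a) = 0 := by
  rw [k.res_tr _ _ _ _ (isCartesian_fromEmpty h), Subsingleton.elim (k.res _ a) 0, map_zero]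

theorem res_nm_of_disjoint {X Y Z : FinGSet G} {i : X →[G] Z} {j : Y →[G] Z}
    (h : ∀ x y, i x ≠ j y) (a : k.obj X) : k.res j (k.nm i a) = 1 := by
  rw [k.res_nm _ _ _ _ (isCartesian_fromEmpty h), Subsingleton.elim (k.res _ a) 1, map_one]

variable {X Y Z : FinGSet G} {i : X →[G] Z} {j : Y →[G] Z}

theorem ext_of_disjointUnion (h : IsDisjointUnion i j) {a b : k.obj Z}
    (h₁ : k.res i a = k.res i b) (h₂ : k.res j a = k.res j b) : a = b :=
  (k.bijective_of_isDisjointUnion i j h).1 (Prod.ext h₁ h₂)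

theorem injective_left (h : IsDisjointUnion i j) : Function.Injective i := fun x y hxy =>
  Sum.inl.inj (h.1 (a₁ := Sum.inl x) (a₂ := Sum.inl y) hxy)

theorem injective_right (h : IsDisjointUnion i j) : Function.Injective j := fun x y hxy =>
  Sum.inr.inj (h.1 (a₁ := Sum.inr x) (a₂ := Sum.inr y) hxy)

theorem left_ne_right (h : IsDisjointUnion i j) (x : X) (y : Y) : i x ≠ j y := fun hxy =>
  Sum.inl_ne_inr (h.1 (a₁ := Sum.inl x) (a₂ := Sum.inr y) hxy)

theorem tr_res_add_tr_res (h : IsDisjointUnion i j) (a : k.obj Z) :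
    k.tr i (k.res i a) + k.tr j (k.res j a) = a := by
  refine k.ext_of_disjointUnion h ?_ ?_
  · rw [map_add, res_tr_of_injective k (injective_left h),
      res_tr_of_disjoint k fun y x => (left_ne_right h x y).symm, add_zero]
  · rw [map_add, res_tr_of_injective k (injective_right h),
      res_tr_of_disjoint k (left_ne_right h), zero_add]

theorem nm_res_mul_nm_res (h : IsDisjointUnion i j) (a : k.obj Z) :
    k.nm i (k.res i a) * k.nm j (k.res j a) = a := by
  refine k.ext_of_disjointUnion h ?_ ?_
  · rw [map_mul, res_nm_of_injective k (injective_left h),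
      res_nm_of_disjoint k fun y x => (left_ne_right h x y).symm, mul_one]
  · rw [map_mul, res_nm_of_injective k (injective_right h),
      res_nm_of_disjoint k (left_ne_right h), one_mul]

/-- Restriction along a bijection is injective. -/
theorem res_injective_of_bijective {X Y : FinGSet G} {f : X →[G] Y} (hf : Function.Bijective f) :
    Function.Injective (k.res f) := by
  intro a b h
  have : IsDisjointUnion f (fromEmpty Y) := by
    constructor
    · rintro (x | x) (y | y) h
      · exact congrArg _ (hf.1 h)
      · exact y.elim
      · exact x.elim
      · exact y.elim
    · intro y
      obtain ⟨x, rfl⟩ := hf.2 y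
      exact ⟨Sum.inl x, rfl⟩
  exact k.ext_of_disjointUnion this h (Subsingleton.elim _ _)

theorem isDisjointUnion_copies (T : Type) [Finite T] (X : FinGSet G) :
    IsDisjointUnion (copiesMap (some : T → Option T) X) (copiesIncl X (none : Option T)) := by
  constructor
  · rintro (x | x) (y | y) h
    · obtain ⟨h₁, h₂⟩ := Prod.ext_iff.1 h
      exact congrArg _ (Prod.ext (Option.some_injective _ h₁) h₂)
    · exact absurd (Prod.ext_iff.1 h).1 (Option.some_ne_none _)
    · exact absurd (Prod.ext_iff.1 h).1 (Option.some_ne_none _).symm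
    · exact congrArg _ (Prod.ext_iff.1 h).2
  · rintro ⟨_ | t, x⟩
    · exact ⟨Sum.inr x, rfl⟩
    · exact ⟨Sum.inl (t, x), rfl⟩

/-- The transfer along the fold map adds up the restrictions to the summands. -/
theorem tr_fold (T : Type) [Fintype T] (X : FinGSet G) (a : k.obj (copies T X)) :
    k.tr (fold T X) a = ∑ t, k.res (copiesIncl X t) a := by
  revert a
  refine Fintype.induction_empty_option (P := fun T _ => ∀ a : k.obj (copies T X),
    k.tr (fold T X) a = ∑ t, k.res (copiesIncl X t) a) ?_ ?_ ?_ T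
  · intro S T _ e h a
    let := Fintype.ofEquiv T e.symm
    have he : Function.Injective (copiesMap e X) := fun x y hxy =>
      Prod.ext (e.injective (Prod.ext_iff.1 hxy).1) (Prod.ext_iff.1 hxy).2
    have ha : a = k.tr (copiesMap e X) (k.res (copiesMap e X) a) := by
      refine k.res_injective_of_bijective (f := copiesMap e X) ⟨he, fun x => ?_⟩ ?_
      · exact ⟨(e.symm x.1, x.2), Prod.ext (e.apply_symm_apply x.1) rfl⟩
      · rw [res_tr_of_injective k he]
    conv_lhs => rw [ha]
    rw [k.tr_comp_eq (h := fold S X) rfl, h, ← e.sum_comp]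
    exact Finset.sum_congr rfl fun t _ => k.res_comp_eq rfl a
  · intro a
    have : Subsingleton (k.obj (copies PEmpty X)) := 
      k.subsingleton_of_isEmpty _ (inferInstanceAs (IsEmpty (PEmpty × X)))
    rw [Subsingleton.elim a 0]
    simp
  · intro T _ h a
    conv_lhs => rw [← k.tr_res_add_tr_res (isDisjointUnion_copies T X) a]
    rw [map_add, k.tr_comp_eq (h := fold T X) rfl, h, Fintype.sum_option, add_comm]
    rw [k.tr_comp_eq (h := MulActionHom.id G) rfl, k.tr_id]
    exact congrArg _ (Finset.sum_congr rfl fun t _ => k.res_comp_eq rfl a)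

/-- The norm along the fold map multiplies the restrictions to the summands. -/
theorem nm_fold (T : Type) [Fintype T] (X : FinGSet G) (a : k.obj (copies T X)) :
    k.nm (fold T X) a = ∏ t, k.res (copiesIncl X t) a := by
  revert a
  refine Fintype.induction_empty_option (P := fun T _ => ∀ a : k.obj (copies T X),
    k.nm (fold T X) a = ∏ t, k.res (copiesIncl X t) a) ?_ ?_ ?_ T
  · intro S T _ e h a
    let := Fintype.ofEquiv T e.symm
    have he : Function.Injective (copiesMap e X) := fun x y hxy =>
      Prod.ext (e.injective (Prod.ext_iff.1 hxy).1) (Prod.ext_iff.1 hxy).2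
    have ha : a = k.nm (copiesMap e X) (k.res (copiesMap e X) a) := by
      refine k.res_injective_of_bijective (f := copiesMap e X) ⟨he, fun x => ?_⟩ ?_
      · exact ⟨(e.symm x.1, x.2), Prod.ext (e.apply_symm_apply x.1) rfl⟩
      · rw [res_nm_of_injective k he]
    conv_lhs => rw [ha]
    rw [k.nm_comp_eq (h := fold S X) rfl, h, ← e.prod_comp]
    exact Finset.prod_congr rfl fun t _ => k.res_comp_eq rfl a
  · intro a
    have : Subsingleton (k.obj (copies PEmpty X)) := 
      k.subsingleton_of_isEmpty _ (inferInstanceAs (IsEmpty (PEmpty × X)))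
    rw [Subsingleton.elim a 1]
    simp
  · intro T _ h a
    conv_lhs => rw [← k.nm_res_mul_nm_res (isDisjointUnion_copies T X) a]
    rw [map_mul, k.nm_comp_eq (h := fold T X) rfl, h, Fintype.prod_option, mul_comm]
    rw [k.nm_comp_eq (h := MulActionHom.id G) rfl, k.nm_id]
    exact congrArg _ (Finset.prod_congr rfl fun t _ => k.res_comp_eq rfl a)

end Basic

end TambaraFunctor

/-! ### Evaluation at points -/

namespace TambaraFunctor

open FinGSet

section Iso

variable {G : Type} [Group G]

/-- A family of bijections compatible with the structure is an isomorphism. -/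
noncomputable def isoOfBijective {k l : TambaraFunctor.{u} G} (φ : k ⟶ l)
    (h : ∀ X, Function.Bijective (φ.app X)) : k ≅ l where
  hom := φ
  inv :=
    { app := fun X => (RingEquiv.ofBijective (φ.app X) (h X)).symm
      app_res := fun {X Y} f a => (h X).1 <| by
        rw [φ.app_res]
        exact (RingEquiv.apply_symm_apply (.ofBijective _ (h X)) _).trans
          (congrArg _ (RingEquiv.apply_symm_apply (.ofBijective _ (h Y)) a).symm)
      app_tr := fun {X Y} f a => (h Y).1 <| by
        rw [φ.app_tr]
        exact (RingEquiv.apply_symm_apply (.ofBijective _ (h Y)) _).trans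
          (congrArg _ (RingEquiv.apply_symm_apply (.ofBijective _ (h X)) a).symm)
      app_nm := fun {X Y} f a => (h Y).1 <| by
        rw [φ.app_nm]
        exact (RingEquiv.apply_symm_apply (.ofBijective _ (h Y)) _).trans
          (congrArg _ (RingEquiv.apply_symm_apply (.ofBijective _ (h X)) a).symm) }
  hom_inv_id := Hom.ext (funext fun X => RingHom.ext fun a =>
    RingEquiv.symm_apply_apply (.ofBijective _ (h X)) a)
  inv_hom_id := Hom.ext (funext fun X => RingHom.ext fun a =>
    RingEquiv.apply_symm_apply (.ofBijective _ (h X)) a)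

theorem hom_inv_app {k l : TambaraFunctor.{u} G} (φ : k ≅ l) (X : FinGSet G) (a : k.obj X) :
    φ.inv.app X (φ.hom.app X a) = a :=
  congrArg (fun ψ : k ⟶ k => ψ.app X a) φ.hom_inv_id

theorem inv_hom_app {k l : TambaraFunctor.{u} G} (φ : k ≅ l) (X : FinGSet G) (a : l.obj X) :
    φ.hom.app X (φ.inv.app X a) = a :=
  congrArg (fun ψ : l ⟶ l => ψ.app X a) φ.inv_hom_id

/-- The isomorphism on values at `X` given by an isomorphism of Tambara functors. -/
def appEquiv {k l : TambaraFunctor.{u} G} (φ : k ≅ l) (X : FinGSet G) : k.obj X ≃+* l.obj X :=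
  { φ.hom.app X with
    invFun := φ.inv.app X
    left_inv := hom_inv_app φ X
    right_inv := inv_hom_app φ X }

theorem appEquiv_apply {k l : TambaraFunctor.{u} G} (φ : k ≅ l) (X : FinGSet G) (a : k.obj X) :
    appEquiv φ X a = φ.hom.app X a := rfl

end Iso

section Eval

variable {G : Type} [Group G] [Finite G] (k : TambaraFunctor.{u} G)

/-- The value in `k(G/e)` of an element of `k(X)` at a point of `X`. -/
def eval {X : FinGSet G} (x : X) : k.obj X →+* k.bottom := k.res (orbitMap x)

theorem eval_res {X Y : FinGSet G} (f : X →[G] Y) (x : X) (a : k.obj Y) :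
    k.eval x (k.res f a) = k.eval (f x) a :=
  k.res_comp_eq (comp_orbitMap f x) a

theorem eval_smul {X : FinGSet G} (g : G) (x : X) (a : k.obj X) :
    k.eval (g • x) a = g • k.eval x a :=
  (k.res_comp_eq (orbitMap_smul g x).symm a).symm

theorem eval_bottom (g : G) (a : k.bottom) : k.eval (X := free G) g a = g • a := rfl

theorem eval_bottom_one (a : k.bottom) : k.eval (X := free G) (1 : G) a = a := by
  rw [eval_bottom, one_smul]

/-- The pullback of `f` along the map `G/e → Y` given by `y` consists of one copy of `G/e` for each
point of the fibre over `y`. -/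
theorem isCartesian_fiber {X Y : FinGSet G} (f : X →[G] Y) (y : Y) (W : X → Prop)
    (hW : ∀ x, W x ↔ f x = y) (p : copies {x // W x} (free G) →[G] X)
    (hp : ∀ (x : {x // W x}) (g : G), p ((x, g) : {x // W x} × G) = g • x.1) :
    IsCartesian p (fold {x // W x} (free G)) f (orbitMap y) := by
  constructor
  · rintro ⟨x, g⟩
    exact (congrArg f (hp x g)).trans ((map_smul f g x.1).trans
      (congrArg (g • ·) ((hW x.1).1 x.2)))
  · intro x (g : G) (h : f x = g • y)
    refine ⟨(⟨g⁻¹ • x, (hW _).2 (by rw [map_smul, h, inv_smul_smul])⟩, g),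
      ⟨(hp _ _).trans (smul_inv_smul g x), rfl⟩, ?_⟩
    rintro ⟨x', g'⟩ ⟨h₁, h₂⟩
    obtain rfl : g' = g := h₂
    refine Prod.ext (Subtype.ext ?_) rfl
    exact ((congrArg (g'⁻¹ • ·) h₁).symm.trans ((congrArg (g'⁻¹ • ·) (hp x' g')).trans
      (inv_smul_smul g' x'.1))).symm

/-- The map from the copies of `G` indexed by a set of points. -/
def copiesOrbitMap {X : FinGSet G} (W : X → Prop) : copies {x // W x} (free G) →[G] X where
  toFun a := orbitMap a.1.1 a.2
  map_smul' g a := mul_smul g a.2 a.1.1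

/-- Values of transfers are sums over fibres, by base change along `G/e → Y`. -/
theorem eval_tr {X Y : FinGSet G} (f : X →[G] Y) (y : Y) (a : k.obj X) :
    k.eval y (k.tr f a) = fiberSum f (fun x => k.eval x a) y := by
  classical
  have := Fintype.ofFinite X
  rw [fiberSum_def, ← Finset.sum_subtype_eq_sum_filter, Finset.subtype_univ]
  refine (k.res_tr _ _ _ _ (isCartesian_fiber f y (fun x => f x = y) (fun _ => Iff.rfl)
    (copiesOrbitMap _) fun _ _ => rfl) a).trans ?_
  rw [tr_fold]
  exact Finset.sum_congr rfl fun x _ => k.res_comp_eq rfl a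

/-- Values of norms are products over fibres, by base change along `G/e → Y`. -/
theorem eval_nm {X Y : FinGSet G} (f : X →[G] Y) (y : Y) (a : k.obj X) :
    k.eval y (k.nm f a) = fiberProd f (fun x => k.eval x a) y := by
  classical
  have := Fintype.ofFinite X
  rw [fiberProd_def, ← Finset.prod_subtype_eq_prod_filter, Finset.subtype_univ]
  refine (k.res_nm _ _ _ _ (isCartesian_fiber f y (fun x => f x = y) (fun _ => Iff.rfl)
    (copiesOrbitMap _) fun _ _ => rfl) a).trans ?_
  rw [nm_fold]
  exact Finset.prod_congr rfl fun x _ => k.res_comp_eq rfl a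

theorem app_eval {k l : TambaraFunctor.{u} G} (φ : k ⟶ l) {X : FinGSet G} (x : X) (a : k.obj X) :
    φ.app _ (k.eval x a) = l.eval x (φ.app X a) :=
  φ.app_res _ a

/-- At a point with trivial stabilizer every value occurs. -/
theorem exists_eval_eq_of_stabilizer_eq_bot {X : FinGSet G} {x : X}
    (h : MulAction.stabilizer G x = ⊥) (v : k.bottom) : ∃ b : k.obj X, k.eval x b = v :=
  ⟨k.tr (orbitMap x) v, k.res_tr_of_injective (orbitMap_injective h) v⟩

/-- The values of a Tambara functor can be prescribed orbit by orbit: an equivariant function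
which is pointwise a value of some element is globally given by one element. -/
theorem exists_forall_eval_eq {X : FinGSet G} (h : X → k.bottom)
    (hG : ∀ (g : G) x, h (g • x) = g • h x) (hloc : ∀ x, ∃ b : k.obj X, k.eval x b = h x) :
    ∃ b : k.obj X, ∀ x, k.eval x b = h x := by
  classical
  have := Fintype.ofFinite X
  suffices H : ∀ T : Finset X, ∃ b : k.obj X, ∀ x ∈ T, k.eval x b = h x by
    obtain ⟨b, hb⟩ := H Finset.univ
    exact ⟨b, fun x => hb x (Finset.mem_univ x)⟩
  intro T
  induction T using Finset.induction_on with
  | empty => exact ⟨0, by simp⟩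
  | insert y T _ ih =>
    obtain ⟨b, hb⟩ := ih
    obtain ⟨c, hc⟩ := hloc y
    -- replace `b` by `c` on the orbit of `y`
    obtain ⟨d, hd⟩ := (k.bijective_of_isDisjointUnion _ _ (isDisjointUnion_incl_compl
      (orbitOf y))).2 (k.res (incl (orbitOf y)) c, k.res (incl (orbitOf y)ᶜ) b)
    obtain ⟨hd₁, hd₂⟩ := Prod.ext_iff.1 hd
    have H₁ : ∀ x ∈ orbitOf y, k.eval x d = h x := by
      intro x hx
      have := congrArg (k.eval (⟨x, hx⟩ : sub X (orbitOf y))) hd₁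
      rw [eval_res, eval_res] at this
      obtain ⟨g, rfl⟩ := hx
      exact this.trans ((k.eval_smul g y c).trans (by rw [hc, ← hG]))
    refine ⟨d, fun x hx => ?_⟩
    by_cases hxy : x ∈ orbitOf y
    · exact H₁ x hxy
    · rcases Finset.mem_insert.1 hx with rfl | hx
      · exact absurd ⟨1, one_smul G x⟩ hxy
      · have := congrArg (k.eval (⟨x, hxy⟩ : sub X (orbitOf y)ᶜ)) hd₂
        rw [eval_res, eval_res] at this
        exact this.trans (hb x hx)

/-- Elements are determined by their values at points. Equivalently, all restrictions to `G/e` from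
orbits are injective, that is, `k` embeds into the fixed point functor of `k(G/e)`. -/
def IsFaithful : Prop :=
  ∀ ⦃X : FinGSet G⦄ ⦃a b : k.obj X⦄, (∀ x, k.eval x a = k.eval x b) → a = b

variable {k}

theorem IsFaithful.injective_res (hk : k.IsFaithful) {X Y : FinGSet G} {f : X →[G] Y}
    (hf : ∀ y, ∃ (x : X) (g : G), y = g • f x) : Function.Injective (k.res f) := by
  intro a b h
  refine hk fun y => ?_
  obtain ⟨x, g, rfl⟩ := hf y
  rw [eval_smul, eval_smul, ← eval_res, ← eval_res, h]

theorem IsFaithful.injective_resTopBottom (hk : k.IsFaithful) :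
    Function.Injective k.resTopBottom :=
  hk.injective_res fun _ => ⟨(1 : G), 1, rfl⟩

theorem IsFaithful.of_iso {k l : TambaraFunctor.{u} G} (φ : k ≅ l) (hl : l.IsFaithful) :
    k.IsFaithful := by
  intro X a b h
  refine (appEquiv φ X).injective (hl fun x => ?_)
  rw [appEquiv_apply, appEquiv_apply, ← app_eval, ← app_eval, h]

theorem IsFaithful.hom_ext {k l : TambaraFunctor.{u} G} (hl : l.IsFaithful) {φ ψ : k ⟶ l}
    (h : ∀ a : k.bottom, φ.app _ a = ψ.app _ a) : φ = ψ :=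
  Hom.ext (funext fun X => RingHom.ext fun a => hl fun x => by
    rw [← app_eval, ← app_eval, h])

/-- Faithful Tambara functors are isomorphic when their bottom rings are, by an equivariant
isomorphism under which the values at every point correspond. -/
theorem exists_iso_of_bottom {k l : TambaraFunctor.{u} G} (hk : k.IsFaithful) (hl : l.IsFaithful)
    (θ : k.bottom ≃+* l.bottom) (hθ : ∀ (g : G) a, θ (g • a) = g • θ a)
    (h₁ : ∀ (X : FinGSet G) (x : X) (a : k.obj X), ∃ b : l.obj X, l.eval x b = θ (k.eval x a))
    (h₂ : ∀ (X : FinGSet G) (x : X) (b : l.obj X), ∃ a : k.obj X, l.eval x b = θ (k.eval x a)) :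
    ∃ ψ : k ≅ l, ∀ a : k.bottom, ψ.hom.app _ a = θ a := by
  have H : ∀ (X : FinGSet G) (a : k.obj X), ∃ b : l.obj X, ∀ x, l.eval x b = θ (k.eval x a) :=
    fun X a => l.exists_forall_eval_eq (fun x => θ (k.eval x a))
      (fun g x => by rw [eval_smul, hθ]) fun x => h₁ X x a
  choose ψ hψ using H
  let Ψ : k ⟶ l :=
    { app := fun X =>
        { toFun := ψ X
          map_one' := hl fun x => by rw [hψ]; simp
          map_mul' := fun a b => hl fun x => by rw [hψ, map_mul, map_mul, map_mul, hψ, hψ]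
          map_zero' := hl fun x => by rw [hψ]; simp
          map_add' := fun a b => hl fun x => by rw [hψ, map_add, map_add, map_add, hψ, hψ] }
      app_res := fun f a => hl fun x => by
        change l.eval x (ψ _ _) = l.eval x (l.res f (ψ _ _))
        rw [hψ, eval_res, eval_res, hψ]
      app_tr := fun {X Y} f a => hl fun x => by
        change l.eval x (ψ _ _) = l.eval x (l.tr f (ψ _ _))
        rw [hψ, eval_tr, eval_tr]
        exact (map_fiberSum (θ : k.bottom →+* l.bottom).toAddMonoidHom _ _ _).trans
          (fiberSum_congr f fun x _ => (hψ X a x).symm)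
      app_nm := fun {X Y} f a => hl fun x => by
        change l.eval x (ψ _ _) = l.eval x (l.nm f (ψ _ _))
        rw [hψ, eval_nm, eval_nm]
        exact (map_fiberProd (θ : k.bottom →+* l.bottom).toMonoidHom _ _ _).trans
          (fiberProd_congr f fun x _ => (hψ X a x).symm) }
  refine ⟨isoOfBijective Ψ fun X => ⟨fun a b hab => hk fun x => θ.injective ?_, fun b => ?_⟩, ?_⟩
  · rw [← hψ, ← hψ]
    exact congrArg (l.eval x) hab
  · obtain ⟨a, ha⟩ := k.exists_forall_eval_eq (fun x : X => θ.symm (l.eval x b))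
      (fun g x => θ.injective (by rw [hθ]; simp [eval_smul]))
      fun x => by
        obtain ⟨a, ha⟩ := h₂ X x b
        exact ⟨a, by rw [ha, θ.symm_apply_apply]⟩
    exact ⟨a, hl fun x => (hψ X a x).trans (by rw [ha, θ.apply_symm_apply])⟩
  · intro a
    change ψ _ a = θ a
    have := hψ (free G) a (1 : G)
    rwa [eval_bottom_one, eval_bottom_one] at this

end Eval

/-! ### Clarified Tambara fields -/

section KernelPair

variable {G : Type} [Group G] {k l : TambaraFunctor.{u} G}

/-- The kernel pair of a morphism: the pairs of elements with the same image. -/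
def kernelPair (φ : k ⟶ l) : TambaraFunctor.{u} G where
  obj X := ((φ.app X).comp (RingHom.fst (k.obj X) (k.obj X))).eqLocus
    ((φ.app X).comp (RingHom.snd (k.obj X) (k.obj X)))
  res f :=
    { toFun := fun a => ⟨(k.res f a.1.1, k.res f a.1.2),
        (φ.app_res f _).trans ((congrArg (l.res f) a.2).trans (φ.app_res f _).symm)⟩
      map_one' := Subtype.ext (Prod.ext (map_one (k.res f)) (map_one (k.res f)))
      map_mul' := fun _ _ => Subtype.ext (Prod.ext (map_mul (k.res f) _ _) (map_mul (k.res f) _ _))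
      map_zero' := Subtype.ext (Prod.ext (map_zero (k.res f)) (map_zero (k.res f)))
      map_add' := fun _ _ =>
        Subtype.ext (Prod.ext (map_add (k.res f) _ _) (map_add (k.res f) _ _)) }
  tr f :=
    { toFun := fun a => ⟨(k.tr f a.1.1, k.tr f a.1.2),
        (φ.app_tr f _).trans ((congrArg (l.tr f) a.2).trans (φ.app_tr f _).symm)⟩
      map_zero' := Subtype.ext (Prod.ext (map_zero (k.tr f)) (map_zero (k.tr f)))
      map_add' := fun _ _ =>
        Subtype.ext (Prod.ext (map_add (k.tr f) _ _) (map_add (k.tr f) _ _)) }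
  nm f :=
    { toFun := fun a => ⟨(k.nm f a.1.1, k.nm f a.1.2),
        (φ.app_nm f _).trans ((congrArg (l.nm f) a.2).trans (φ.app_nm f _).symm)⟩
      map_one' := Subtype.ext (Prod.ext (map_one (k.nm f)) (map_one (k.nm f)))
      map_mul' := fun _ _ =>
        Subtype.ext (Prod.ext (map_mul (k.nm f) _ _) (map_mul (k.nm f) _ _)) }
  res_id _ _ := Subtype.ext (Prod.ext (k.res_id _ _) (k.res_id _ _))
  tr_id _ _ := Subtype.ext (Prod.ext (k.tr_id _ _) (k.tr_id _ _))
  nm_id _ _ := Subtype.ext (Prod.ext (k.nm_id _ _) (k.nm_id _ _))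
  res_comp g f _ := Subtype.ext (Prod.ext (k.res_comp g f _) (k.res_comp g f _))
  tr_comp g f _ := Subtype.ext (Prod.ext (k.tr_comp g f _) (k.tr_comp g f _))
  nm_comp g f _ := Subtype.ext (Prod.ext (k.nm_comp g f _) (k.nm_comp g f _))
  subsingleton_of_isEmpty X hX :=
    have := k.subsingleton_of_isEmpty X hX
    inferInstance
  bijective_of_isDisjointUnion i j h := by
    constructor
    · intro a b hab
      obtain ⟨h₁, h₂⟩ := Prod.ext_iff.1 hab
      obtain ⟨h₃, h₄⟩ := Prod.ext_iff.1 (Subtype.ext_iff.1 h₁)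
      obtain ⟨h₅, h₆⟩ := Prod.ext_iff.1 (Subtype.ext_iff.1 h₂)
      exact Subtype.ext (Prod.ext (k.ext_of_disjointUnion h h₃ h₅)
        (k.ext_of_disjointUnion h h₄ h₆))
    · rintro ⟨a, b⟩
      obtain ⟨c, hc⟩ := (k.bijective_of_isDisjointUnion i j h).2 (a.1.1, b.1.1)
      obtain ⟨d, hd⟩ := (k.bijective_of_isDisjointUnion i j h).2 (a.1.2, b.1.2)
      obtain ⟨hc₁, hc₂⟩ := Prod.ext_iff.1 hc
      obtain ⟨hd₁, hd₂⟩ := Prod.ext_iff.1 hd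
      refine ⟨⟨(c, d), l.ext_of_disjointUnion h ?_ ?_⟩, Prod.ext
        (Subtype.ext (Prod.ext hc₁ hd₁)) (Subtype.ext (Prod.ext hc₂ hd₂))⟩
      · exact (φ.app_res i c).symm.trans ((congrArg _ hc₁).trans
          (a.2.trans ((congrArg _ hd₁).symm.trans (φ.app_res i d))))
      · exact (φ.app_res j c).symm.trans ((congrArg _ hc₂).trans
          (b.2.trans ((congrArg _ hd₂).symm.trans (φ.app_res j d))))
  res_tr p q f g h a := Subtype.ext (Prod.ext (k.res_tr p q f g h _) (k.res_tr p q f g h _))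
  res_nm p q f g h a := Subtype.ext (Prod.ext (k.res_nm p q f g h _) (k.res_nm p q f g h _))
  nm_tr f g h p q e he a :=
    Subtype.ext (Prod.ext (k.nm_tr f g h p q e he _) (k.nm_tr f g h p q e he _))

end KernelPair

end TambaraFunctor

section GSimple

variable {G : Type} [Group G]

/-- A ring coinduced from a proper subgroup contains a nontrivial idempotent. -/
theorem not_isField_coindRing {H : Subgroup G} (hH : H ≠ ⊤) (S : Type u) [CommRing S]
    [MulSemiringAction H S] : ¬ IsField (coindRing H S) := by
  classical
  intro hF
  let := hF.toField
  have hS : Nontrivial S := by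
    by_contra h
    rw [not_nontrivial_iff_subsingleton] at h
    exact zero_ne_one (α := coindRing H S) (Subsingleton.elim _ _)
  let e : coindRing H S := ⟨fun x => if x ∈ H then 1 else 0, fun h x => by
    by_cases hx : x ∈ H
    · simp [hx, H.mul_mem h.2 hx]
    · simp [hx, Subgroup.mul_mem_cancel_left]⟩
  have he : e * e = e := Subtype.ext <| funext fun x => by
    change (if x ∈ H then (1 : S) else 0) * (if x ∈ H then 1 else 0) = if x ∈ H then 1 else 0
    split_ifs <;> simp
  obtain ⟨x, hx⟩ : ∃ x, x ∉ H := by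
    by_contra! h
    exact hH ((Subgroup.eq_top_iff' H).2 h)
  rcases IsIdempotentElem.iff_eq_zero_or_one.1 he with h | h
  · have := congrFun (congrArg Subtype.val h) 1
    simp [e] at this
  · have := congrFun (congrArg Subtype.val h) x
    simp [e, hx] at this

variable [Finite G] (R : Type u) [CommRing R] [MulSemiringAction G R]

/-- The subgroup of elements stabilizing an ideal. -/
def idealStabilizer (m : Ideal R) : Subgroup G where
  carrier := {g | ∀ a : R, g • a ∈ m ↔ a ∈ m}
  one_mem' a := by rw [one_smul]
  mul_mem' {g h} hg hh a := by rw [mul_smul, hg, hh]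
  inv_mem' {g} hg a := by rw [← hg, smul_inv_smul]

variable {R}

/-- The action of its stabilizer on the quotient by an ideal. -/
abbrev idealStabilizer.action (m : Ideal R) :
    MulSemiringAction (idealStabilizer (G := G) R m) (R ⧸ m) where
  smul h := Ideal.quotientMap m (MulSemiringAction.toRingHom G R h) fun a ha => (h.2 a).2 ha
  one_smul := by
    rintro ⟨a⟩
    exact congrArg (Ideal.Quotient.mk m) (one_smul G a)
  mul_smul := by
    rintro g h ⟨a⟩
    exact congrArg (Ideal.Quotient.mk m) (mul_smul (g : G) (h : G) a)
  smul_zero _ := map_zero _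
  smul_add _ := map_add _
  smul_one _ := map_one _
  smul_mul _ := map_mul _

/-- A nonzero `G`-ring without nontrivial `G`-stable ideals is a field or coinduced from a proper
subgroup, namely from the action of the stabilizer of a maximal ideal on its residue field. -/
theorem isField_or_exists_equiv_coindRing [Nontrivial R]
    (hR : ∀ I : Ideal R, (∀ (g : G) a, a ∈ I → g • a ∈ I) → I ≠ ⊤ → I = ⊥) :
    IsField R ∨ ∃ (H : Subgroup G) (_ : H ≠ ⊤) (S : Type u) (_ : CommRing S)
      (_ : MulSemiringAction H S) (ε : R ≃+* coindRing H S), ∀ (g : G) (a : R),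
        ε (g • a) = g • ε a := by
  obtain ⟨m, hm⟩ := Ideal.exists_maximal R
  by_cases hH : idealStabilizer (G := G) R m = ⊤
  · left
    have : m = ⊥ := hR m (fun g a ha =>
      ((show g ∈ idealStabilizer R m from hH ▸ Subgroup.mem_top g) a).2 ha) hm.ne_top
    subst this
    exact Ring.isField_iff_maximal_bot.2 hm
  right
  set H := idealStabilizer (G := G) R m with hHdef
  let := idealStabilizer.action (G := G) m
  refine ⟨H, hH, R ⧸ m, inferInstance, inferInstance, ?_⟩
  let J : G → Ideal R := fun x => m.comap (MulSemiringAction.toRingHom G R x)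
  have hJ : ∀ x a, a ∈ J x ↔ x • a ∈ m := fun _ _ => Iff.rfl
  have hJm : ∀ x, (J x).IsMaximal := fun x =>
    Ideal.comap_isMaximal_of_surjective _ (MulAction.surjective x)
  have hJH : ∀ x y, J x = J y → x * y⁻¹ ∈ H := by
    intro x y hxy a
    rw [mul_smul, ← hJ, hxy, hJ, smul_inv_smul]
  let ε : R →+* coindRing H (R ⧸ m) :=
    { toFun := fun a => ⟨fun x => Ideal.Quotient.mk m (x • a), fun h x =>
        congrArg (Ideal.Quotient.mk m) (mul_smul (h : G) x a)⟩
      map_one' := Subtype.ext <| funext fun x => by simp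
      map_mul' := fun a b => Subtype.ext <| funext fun x => by simp
      map_zero' := Subtype.ext <| funext fun x => by simp
      map_add' := fun a b => Subtype.ext <| funext fun x => by simp }
  have hε : ∀ a x, (ε a).1 x = Ideal.Quotient.mk m (x • a) := fun _ _ => rfl
  refine ⟨RingEquiv.ofBijective ε ⟨?_, ?_⟩, fun g a => ?_⟩
  · rw [RingHom.injective_iff_ker_eq_bot]
    refine hR _ (fun g a ha => ?_) (RingHom.ker_ne_top ε)
    rw [RingHom.mem_ker] at ha ⊢
    refine Subtype.ext <| funext fun x => ?_
    rw [hε, ← mul_smul, ← hε, ha]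
    rfl
  · intro f
    have hcop : Pairwise fun p q : Quotient (QuotientGroup.rightRel H) =>
        IsCoprime (J p.out) (J q.out) := by
      intro p q hpq
      have := hJm p.out
      have := hJm q.out
      refine MaximalSpectrum.isCoprime_of_ne (I := ⟨_, hJm p.out⟩) (J := ⟨_, hJm q.out⟩)
        fun h => ?_
      have hout := Quotient.sound (s := QuotientGroup.rightRel H)
        (QuotientGroup.rightRel_apply.2 (hJH _ _ (congrArg MaximalSpectrum.asIdeal h)))
      rw [p.out_eq, q.out_eq] at hout
      exact hpq hout.symm
    choose c hc using fun x => Ideal.Quotient.mk_surjective (I := m) (f.1 x)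
    obtain ⟨a, ha⟩ := Ideal.pi_quotient_surjective hcop
      fun q => Ideal.Quotient.mk _ (q.out⁻¹ • c q.out)
    refine ⟨a, Subtype.ext <| funext fun x => ?_⟩
    let q : Quotient (QuotientGroup.rightRel H) := Quotient.mk _ x
    have hq : Ideal.Quotient.mk m (q.out • a) = f.1 q.out := by
      have := (hJ _ _).1 (Ideal.Quotient.eq.1 (ha q))
      rw [smul_sub, smul_inv_smul] at this
      rw [← hc, Ideal.Quotient.eq]
      exact this
    have hx : x * q.out⁻¹ ∈ H := QuotientGroup.rightRel_apply.1 (Quotient.mk_out x)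
    obtain ⟨h, hh⟩ : ∃ h : H, x = h * q.out := ⟨⟨_, hx⟩, by simp⟩
    rw [hh, (ε a).2, f.2, hε, hq]
  · exact Subtype.ext <| funext fun x => by
      change Ideal.Quotient.mk m (x • g • a) = Ideal.Quotient.mk m ((x * g) • a)
      rw [mul_smul]

end GSimple

namespace TambaraFunctor

open FinGSet

variable {G : Type} [Group G]

theorem mono_of_injective_app {k l : TambaraFunctor.{u} G} (φ : k ⟶ l)
    (h : ∀ X, Function.Injective (φ.app X)) : Mono φ :=
  ⟨fun _ _ hαβ => Hom.ext (funext fun X => RingHom.ext fun a =>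
    h X (congrArg (fun ψ => Hom.app ψ X a) hαβ))⟩

/-- The two projections from the kernel pair of a monomorphism agree. -/
theorem injective_of_mono {k l : TambaraFunctor.{u} G} (φ : k ⟶ l) [Mono φ] (X : FinGSet G) :
    Function.Injective (φ.app X) := by
  let π₁ : kernelPair φ ⟶ k :=
    { app := fun X => (RingHom.fst _ _).comp (Subring.subtype _)
      app_res := fun _ _ => rfl
      app_tr := fun _ _ => rfl
      app_nm := fun _ _ => rfl }
  let π₂ : kernelPair φ ⟶ k :=
    { app := fun X => (RingHom.snd _ _).comp (Subring.subtype _)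
      app_res := fun _ _ => rfl
      app_tr := fun _ _ => rfl
      app_nm := fun _ _ => rfl }
  have h : π₁ ≫ φ = π₂ ≫ φ := Hom.ext (funext fun X => RingHom.ext fun a => a.2)
  intro a b hab
  exact congrArg (fun ψ : kernelPair φ ⟶ k => ψ.app X ⟨(a, b), hab⟩)
    (Mono.right_cancellation _ _ h)

/-- The functor of fixed points of an equivariant ring map. -/
def fixedFunctorMap {R S : Type u} [CommRing R] [MulSemiringAction G R] [CommRing S]
    [MulSemiringAction G S] (ρ : R →+* S) (hρ : ∀ (g : G) a, ρ (g • a) = g • ρ a) :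
    fixedFunctor (G := G) R ⟶ fixedFunctor S where
  app X :=
    { toFun := fun a => ⟨fun x => ρ (a.1 x), fun g x => by
        rw [← hρ]; exact congrArg ρ (a.2 g x)⟩
      map_one' := Subtype.ext (funext fun _ => map_one ρ)
      map_mul' := fun _ _ => Subtype.ext (funext fun _ => map_mul ρ _ _)
      map_zero' := Subtype.ext (funext fun _ => map_zero ρ)
      map_add' := fun _ _ => Subtype.ext (funext fun _ => map_add ρ _ _) }
  app_res _ _ := rfl
  app_tr f a := Subtype.ext (funext fun x => map_fiberSum ρ.toAddMonoidHom f a.1 x)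
  app_nm f a := Subtype.ext (funext fun x => map_fiberProd ρ.toMonoidHom f a.1 x)

variable [Finite G]

/-- The map from a Tambara functor to the fixed point functor of its bottom ring. -/
def evalHom (k : TambaraFunctor.{u} G) : k ⟶ fixedFunctor k.bottom where
  app _ :=
    { toFun := fun a => ⟨fun x => k.eval x a, fun g x => k.eval_smul g x a⟩
      map_one' := Subtype.ext (funext fun x => map_one (k.eval x))
      map_mul' := fun a b => Subtype.ext (funext fun x => map_mul (k.eval x) a b)
      map_zero' := Subtype.ext (funext fun x => map_zero (k.eval x))
      map_add' := fun a b => Subtype.ext (funext fun x => map_add (k.eval x) a b) }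
  app_res f a := Subtype.ext (funext fun x => k.eval_res f x a)
  app_tr f a := Subtype.ext (funext fun x => k.eval_tr f x a)
  app_nm f a := Subtype.ext (funext fun x => k.eval_nm f x a)

theorem isNonzero_fixedFunctor (R : Type u) [CommRing R] [MulSemiringAction G R] [Nontrivial R] :
    (fixedFunctor (G := G) R).IsNonzero :=
  ⟨free G, inferInstanceAs (Nontrivial (equivariantFunctions R (free G)))⟩

/-- The norm of `0` is `0`: this `0` is the transfer from the empty set, and the dependent product
of the empty set along the surjection `G/e → G/G` is empty. -/
theorem nm_toPoint_zero (k : TambaraFunctor.{u} G) : k.nm (toPoint G) 0 = 0 := by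
  have h : IsExponential (fromEmpty (free G)) (toPoint G) (fromEmpty (point G))
      (fromEmpty (free G)) (MulActionHom.id G : empty G →[G] empty G)
      (MulActionHom.id G : empty G →[G] empty G) :=
    ⟨⟨fun r => r.elim, fun _ b => b.elim⟩, fun r => r.elim, fun y s => (s ⟨(1 : G), rfl⟩).elim⟩
  have := k.nm_tr _ _ _ _ _ _ h 0
  rw [map_zero] at this
  rw [this, Subsingleton.elim (k.nm _ _) 0, map_zero]

/-- If `0 = 1` in `k(G/e)`, then taking norms gives `0 = 1` in `k(G/G)`, hence everywhere. -/
theorem IsNonzero.nontrivial_bottom {k : TambaraFunctor.{u} G} (hk : k.IsNonzero) :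
    Nontrivial k.bottom := by
  by_contra h
  rw [not_nontrivial_iff_subsingleton] at h
  obtain ⟨X, hX⟩ := hk
  have h₁ : (0 : k.topLevel) = 1 := by
    rw [← nm_toPoint_zero, Subsingleton.elim (0 : k.bottom) 1, map_one]
  let f : X →[G] point G := ⟨fun _ => PUnit.unit, fun _ _ => rfl⟩
  have := congrArg (k.res f) h₁
  rw [map_zero, map_one] at this
  exact zero_ne_one this

/-- The clarified Tambara fields are the subfunctors of fixed point functors of fields with
`G`-action that contain the whole field at the level `G/e`. -/
theorem isClarified_iff (k : TambaraFunctor.{u} G) :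
    k.IsClarified ↔ IsField k.bottom ∧ k.IsFaithful := by
  constructor
  · rintro ⟨⟨hne, hmono⟩, hsep⟩
    have hnt := hne.nontrivial_bottom
    refine ⟨(isField_or_exists_equiv_coindRing (G := G) fun I hI hIt => ?_).resolve_right hsep, ?_⟩
    · -- at the level `G/e`, the map to the fixed point functor of the quotient has kernel `I`
      let : MulSemiringAction G (k.bottom ⧸ I) :=
        { smul := fun g => Ideal.quotientMap I (MulSemiringAction.toRingHom G k.bottom g) (hI g)
          one_smul := by
            rintro ⟨a⟩
            exact congrArg (Ideal.Quotient.mk I) (one_smul G a)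
          mul_smul := by
            rintro g h ⟨a⟩
            exact congrArg (Ideal.Quotient.mk I) (mul_smul g h a)
          smul_zero := fun _ => map_zero _
          smul_add := fun _ => map_add _
          smul_one := fun _ => map_one _
          smul_mul := fun _ => map_mul _ }
      have : Nontrivial (k.bottom ⧸ I) := Ideal.Quotient.nontrivial_iff.2 hIt
      let φ : k ⟶ fixedFunctor (k.bottom ⧸ I) :=
        k.evalHom ≫ fixedFunctorMap (Ideal.Quotient.mk I) fun _ _ => rfl
      have hφ : Mono φ := hmono _ φ (isNonzero_fixedFunctor _)
      refine (Submodule.eq_bot_iff I).2 fun a ha => injective_of_mono φ (free G) ?_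
      rw [map_zero]
      exact Subtype.ext (funext fun g => Ideal.Quotient.eq_zero_iff_mem.2 (hI g a ha))
    · have hφ : Mono k.evalHom := hmono _ _ (isNonzero_fixedFunctor _)
      exact fun X a b h => injective_of_mono k.evalHom X (Subtype.ext (funext h))
  · rintro ⟨hF, hf⟩
    have hnt : Nontrivial k.bottom := hF.nontrivial
    refine ⟨⟨⟨_, hnt⟩, fun l φ hl => mono_of_injective_app φ fun X a b hab => ?_⟩, ?_⟩
    · have := hl.nontrivial_bottom
      let := hF.toField
      refine hf fun x => (φ.app (free G)).injective ?_
      rw [app_eval, app_eval, hab]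
    · rintro ⟨H, hH, S, _, _, ε, -⟩
      exact not_isField_coindRing hH S (MulEquiv.isField hF ε.symm.toMulEquiv)

end TambaraFunctor

/-! ### Points fixed by a normal subgroup -/

namespace FinGSet

variable {G : Type} [Group G] (N : Subgroup G) [N.Normal]

/-- The points of a `G`-set which are fixed by the normal subgroup `N`. -/
def fixedSub (X : FinGSet G) : SubMulAction G X where
  carrier := {x | ∀ n ∈ N, n • x = x}
  smul_mem' g x hx n hn := by
    have := hx (g⁻¹ * n * g) (by simpa using ‹N.Normal›.conj_mem n hn g⁻¹)
    rw [mul_smul, mul_smul, inv_smul_eq_iff] at this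
    exact this

/-- The `G/N`-set of the points fixed by `N`. -/
def fixedPts (X : FinGSet G) : FinGSet (G ⧸ N) where
  carrier := fixedSub N X
  mulAction := MulAction.compHom (fixedSub N X) (QuotientGroup.lift N
    (MulAction.toPermHom G (fixedSub N X)) fun n hn => Equiv.ext fun x => Subtype.ext (x.2 n hn))

variable {N}

/-- The inclusion of the points fixed by `N`. -/
def fixedIncl (X : FinGSet G) : inflate N (fixedPts N X) →[G] X where
  toFun x := x.1
  map_smul' _ _ := rfl

/-- Equivariant maps preserve the points fixed by `N`. -/
def fixedMap {X Y : FinGSet G} (f : X →[G] Y) : fixedPts N X →[G ⧸ N] fixedPts N Y where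
  toFun x := ⟨f x.1, fun n hn => by rw [← map_smul, x.2 n hn]⟩
  map_smul' := by
    rintro ⟨g⟩ x
    exact Subtype.ext (map_smul f g x.1)

variable (N) in
/-- The projection `G/e → G/N`. -/
def quotientProj [Finite G] : free G →[G] inflate N (free (G ⧸ N)) where
  toFun g := (g : G ⧸ N)
  map_smul' _ _ := rfl

/-- The inclusion of a fixed point. -/
def pointMap {X : FinGSet G} (x : X) (hx : ∀ g : G, g • x = x) : point G →[G] X where
  toFun _ := x
  map_smul' g _ := (hx g).symm

end FinGSet

namespace TambaraFunctor

open FinGSet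

/-! ### The pieces of a clarified Tambara field -/

section Pieces

variable {G : Type} [Group G] [Finite G] (N : Subgroup G)

theorem res_freeToIndFree_eval (k : TambaraFunctor.{u} G) {X : FinGSet N} (x : X)
    (a : k.obj (ind N X)) :
    k.res (freeToIndFree N) ((k.restrict N).eval x a) = k.eval (indMk 1 x) a := by
  refine k.res_comp_eq (MulActionHom.ext fun g : G => ?_) a
  change indMk g ((1 : N) • x) = indMk (g * 1) x
  rw [one_smul, mul_one]

theorem IsFaithful.restrict {k : TambaraFunctor.{u} G} (hk : k.IsFaithful) :
    (k.restrict N).IsFaithful := by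
  intro X (a : k.obj (ind N X)) (b : k.obj (ind N X)) h
  refine hk fun z => ?_
  obtain ⟨g, x, rfl⟩ := indMk_surj z
  have hx : k.eval (indMk 1 x) a = k.eval (indMk 1 x) b :=
    (res_freeToIndFree_eval N k x a).symm.trans
      ((congrArg (k.res (freeToIndFree N)) (h x)).trans (res_freeToIndFree_eval N k x b))
  have hg : indMk g x = g • (indMk 1 x : ind N X) := by rw [smul_indMk, mul_one]
  rw [hg, eval_smul, eval_smul, hx]

variable [N.Normal]

/-- Values of the top piece lie in `k(G/N)`; restricted to `k(G/e)` they are the values of `k`. -/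
theorem res_quotientProj_eval (k : TambaraFunctor.{u} G) {X : FinGSet (G ⧸ N)} (x : X)
    (a : k.obj (inflate N X)) :
    k.res (quotientProj N) ((k.topPiece N).eval x a) = k.eval (X := inflate N X) x a :=
  k.res_comp_eq rfl a

/-- The connecting map of the triple of `k` is the restriction `k(G/N) → k(G/e)`. -/
theorem connectingMap_decompose (k : TambaraFunctor.{u} G) (a : k.obj (inflate N (free (G ⧸ N)))) :
    (k.decompose N).connectingMap a = k.res (quotientProj N) a := by
  exact (congrArg (k.res (freeToIndFree N)) (k.res_comp_eq (g := indPointToQuotient N)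
    (f := indMap (toPoint N)) rfl a)).trans
      (k.res_comp_eq (f := freeToIndFree N) (MulActionHom.ext fun _ => rfl) a)

theorem connectingMap_decompose_smul (k : TambaraFunctor.{u} G) (g : G)
    (a : (k.decompose N).top.bottom) :
    (k.decompose N).connectingMap ((g : G ⧸ N) • a) = g • (k.decompose N).connectingMap a := by
  refine (connectingMap_decompose N k _).trans ?_
  refine (k.res_comp_eq (g := inflateMap N (rightMul (g : G ⧸ N))) (f := quotientProj N) rfl
    a).trans ?_
  refine Eq.trans ?_ (congrArg (k.res (rightMul g)) (connectingMap_decompose N k a).symm)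
  exact (k.res_comp_eq (g := quotientProj N) (f := rightMul g) rfl a).symm

theorem botIso_decompose_smul (k : TambaraFunctor.{u} G) (h : N) (a : (k.restrict N).bottom) :
    (k.decompose N).botIso (h • a) = (h : G) • (k.decompose N).botIso a := by
  refine (k.res_comp_eq (g := indMap (rightMul h)) (f := freeToIndFree N) rfl a).trans
    (k.res_comp_eq (g := freeToIndFree N) (f := rightMul (h : G)) ?_ a).symm
  refine MulActionHom.ext fun g : G => ?_
  exact ((indMk_mul (X := free N) g h (1 : N)).trans
    (congrArg (indMk g) ((mul_one h).trans (one_mul h).symm)))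

variable {k : TambaraFunctor.{u} G}

theorem IsFaithful.injective_quotientProj (hk : k.IsFaithful) :
    Function.Injective (k.res (quotientProj N)) :=
  hk.injective_res fun y => by
    obtain ⟨g, rfl⟩ := QuotientGroup.mk_surjective (s := N) y
    exact ⟨(1 : G), g, congrArg _ (mul_one g).symm⟩

theorem IsFaithful.topPiece (hk : k.IsFaithful) : (k.topPiece N).IsFaithful :=
  fun X a b h => hk fun x => (res_quotientProj_eval N k (X := X) x a).symm.trans
    ((congrArg (k.res (quotientProj N)) (h x)).trans (res_quotientProj_eval N k (X := X) x b))

/-- The inverse of `a` in `k(G/N)` is a power of `a` times the norm of its inverse in `k(G/e)`. -/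
theorem IsFaithful.isField_bottom_topPiece (hk : k.IsFaithful) (hF : IsField k.bottom) :
    IsField (k.obj (inflate N (free (G ⧸ N)))) := by
  classical
  have := Fintype.ofFinite G
  let π := quotientProj N
  have hinj : Function.Injective (k.res π) := hk.injective_quotientProj N
  have hnt : Nontrivial k.bottom := hF.nontrivial
  have hnR : Nontrivial (k.obj (inflate N (free (G ⧸ N)))) := (k.res π).domain_nontrivial
  refine ⟨⟨0, 1, zero_ne_one⟩, fun a b => mul_comm a b, fun {a} ha => ?_⟩
  have hra : k.res π a ≠ 0 := fun h => ha (hinj (h.trans (map_zero _).symm))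
  obtain ⟨v, hv⟩ := hF.mul_inv_cancel hra
  obtain ⟨m, hm⟩ : ∃ m, k.nm π (k.res π a) = a ^ (m + 1) := by
    let x : inflate N (free (G ⧸ N)) := (1 : G ⧸ N)
    have hs : (Finset.univ.filter fun g : G => π g = x).card ≠ 0 :=
      Finset.card_ne_zero_of_mem (a := 1) (Finset.mem_filter.2 ⟨Finset.mem_univ _, rfl⟩)
    obtain ⟨m, hm⟩ := Nat.exists_eq_succ_of_ne_zero hs
    refine ⟨m, hinj ?_⟩
    have key : ∀ b, k.res π b = k.eval x b := by
      intro b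
      refine congrArg (fun f => k.res f b) (MulActionHom.ext fun g : G => ?_)
      exact (mul_one (g : G ⧸ N)).symm
    rw [map_pow, key (k.nm π _), eval_nm, fiberProd_congr (b := fun _ => k.res π a)
      (h := fun g hg => by rw [eval_res, hg, key]), fiberProd_def, Finset.prod_const]
    exact congrArg _ hm
  refine ⟨a ^ m * k.nm π v, ?_⟩
  calc a * (a ^ m * k.nm π v) = a ^ (m + 1) * k.nm π v := by ring
    _ = 1 := by rw [← hm, ← map_mul, hv, map_one]

/-- The pieces of a subfunctor of the fixed point functor of a field are again of this kind. -/
theorem IsClarifiedOfChar.isCompatible_decompose {p : ℕ} (hk : k.IsClarifiedOfChar p) :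
    (k.decompose N).IsCompatible p := by
  obtain ⟨hk, hp⟩ := hk
  obtain ⟨hF, hf⟩ := (isClarified_iff k).1 hk
  refine ⟨⟨(isClarified_iff _).2 ⟨hf.isField_bottom_topPiece N hF, hf.topPiece N⟩, ?_⟩, hF,
    ⟨(isClarified_iff _).2 ⟨?_, hf.restrict N⟩, ?_⟩, botIso_decompose_smul N k,
    connectingMap_decompose_smul N k⟩
  · exact (k.res (quotientProj N)).charP (hf.injective_quotientProj N) p
  · exact MulEquiv.isField hF (k.decompose N).botIso.toMulEquiv
  · have : CharP (k.decompose N).field p := hp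
    exact ((k.decompose N).botIso :
      (k.decompose N).bot.bottom →+* (k.decompose N).field).charP
      (k.decompose N).botIso.injective p

end Pieces

/-! ### Reconstruction of the bottom piece -/

section Bottom

variable {G : Type} [Group G] [Finite G]

/-- At a fixed point, a summand `G/G` of `X`, the values are the restrictions from `k(G/G)`. -/
theorem exists_eval_eq_iff_of_fixed (k : TambaraFunctor.{u} G) {X : FinGSet G} {x : X}
    (hx : ∀ g : G, g • x = x) (v : k.bottom) :
    (∃ b : k.obj X, k.eval x b = v) ↔ v ∈ k.resTopBottom.range := by
  have H : ∀ b : k.obj X, k.resTopBottom (k.res (pointMap x hx) b) = k.eval x b := fun b =>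
    k.res_comp_eq (MulActionHom.ext fun g : G => (hx g).symm) b
  constructor
  · rintro ⟨b, rfl⟩
    exact ⟨_, H b⟩
  · rintro ⟨w, rfl⟩
    refine ⟨k.tr (pointMap x hx) w, ?_⟩
    rw [← H, res_tr_of_injective]
    exact fun _ _ _ => rfl

/-- If `G` has no nontrivial proper subgroups, a faithful Tambara functor is determined by the
`G`-ring `k(G/e)` and the image of `k(G/G)` in it. -/
theorem exists_iso_of_range (hG : ∀ H : Subgroup G, H = ⊥ ∨ H = ⊤) {k l : TambaraFunctor.{u} G}
    (hk : k.IsFaithful) (hl : l.IsFaithful) (θ : k.bottom ≃+* l.bottom)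
    (hθ : ∀ (g : G) a, θ (g • a) = g • θ a)
    (hr : ∀ v, θ v ∈ l.resTopBottom.range ↔ v ∈ k.resTopBottom.range) :
    ∃ ψ : k ≅ l, ∀ a : k.bottom, ψ.hom.app _ a = θ a := by
  refine exists_iso_of_bottom hk hl θ hθ (fun X x a => ?_) fun X x b => ?_
  all_goals rcases hG (MulAction.stabilizer G x) with h | h
  · exact l.exists_eval_eq_of_stabilizer_eq_bot h _
  · have hx : ∀ g : G, g • x = x := fun g =>
      MulAction.mem_stabilizer_iff.1 (h ▸ Subgroup.mem_top g)
    exact (l.exists_eval_eq_iff_of_fixed hx _).2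
      ((hr _).2 ((k.exists_eval_eq_iff_of_fixed hx _).1 ⟨a, rfl⟩))
  · obtain ⟨a, ha⟩ := k.exists_eval_eq_of_stabilizer_eq_bot h (θ.symm (l.eval x b))
    exact ⟨a, by rw [ha, θ.apply_symm_apply]⟩
  · have hx : ∀ g : G, g • x = x := fun g =>
      MulAction.mem_stabilizer_iff.1 (h ▸ Subgroup.mem_top g)
    obtain ⟨a, ha⟩ := (k.exists_eval_eq_iff_of_fixed hx (θ.symm (l.eval x b))).2
      ((hr _).1 (by
        rw [θ.apply_symm_apply]
        exact (l.exists_eval_eq_iff_of_fixed hx _).1 ⟨b, rfl⟩))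
    exact ⟨a, by rw [ha, θ.apply_symm_apply]⟩

end Bottom

end TambaraFunctor

section Gluing

open TambaraFunctor

variable {G : Type} [Group G] [Finite G] {N : Subgroup G} [N.Normal]

namespace GluingData

theorem connectingMap_apply (D : GluingData.{u} N) (a : D.top.bottom) :
    D.connectingMap a = D.botIso (D.bot.resTopBottom (D.topIso a)) := rfl

theorem botIso_mem_range_connectingMap (D : GluingData.{u} N) (v : D.bot.bottom) :
    D.botIso v ∈ D.connectingMap.range ↔ v ∈ D.bot.resTopBottom.range := by
  constructor
  · rintro ⟨a, ha⟩
    exact ⟨D.topIso a, D.botIso.injective ha⟩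
  · rintro ⟨w, rfl⟩
    exact ⟨D.topIso.symm w, by rw [connectingMap_apply, D.topIso.apply_symm_apply]⟩

/-- The bottom piece of a compatible triple is determined by the rest: isomorphisms of the top
pieces and of the fields which commute with the connecting maps extend to the triples. -/
theorem exists_iso {p : ℕ} (hN : ∀ H : Subgroup N, H = ⊥ ∨ H = ⊤) {D D' : GluingData.{u} N}
    (hD : D.IsCompatible p) (hD' : D'.IsCompatible p) (α : D.top ≅ D'.top)
    (φ : D.field ≃+* D'.field) (hφ : ∀ (g : G) a, φ (g • a) = g • φ a)
    (h : ∀ a : D.top.bottom, φ (D.connectingMap a) = D'.connectingMap (α.hom.app _ a)) :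
    Nonempty (Iso D D') := by
  have hf := ((isClarified_iff _).1 hD.bot_clarified.1).2
  have hf' := ((isClarified_iff _).1 hD'.bot_clarified.1).2
  let θ : D.bot.bottom ≃+* D'.bot.bottom := (D.botIso.trans φ).trans D'.botIso.symm
  have hθ : ∀ v, D'.botIso (θ v) = φ (D.botIso v) := fun v => D'.botIso.apply_symm_apply _
  obtain ⟨ψ, hψ⟩ := exists_iso_of_range hN hf hf' θ
    (fun g a => D'.botIso.injective (by
      rw [hθ, hD.botIso_smul, hφ, hD'.botIso_smul, hθ]))
    (fun v => by
      rw [← botIso_mem_range_connectingMap, ← botIso_mem_range_connectingMap, hθ]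
      constructor
      · rintro ⟨b, hb⟩
        refine ⟨α.inv.app _ b, φ.injective ?_⟩
        rw [h, inv_hom_app, hb]
      · rintro ⟨a, ha⟩
        exact ⟨_, by rw [← h, ha]⟩)
  refine ⟨⟨α, φ, ψ, hφ, fun a => ?_, fun a => by rw [hψ, hθ]⟩⟩
  apply hf'.injective_resTopBottom
  apply D'.botIso.injective
  rw [← connectingMap_apply, ← h, connectingMap_apply]
  change _ = D'.botIso (D'.bot.res _ _)
  rw [← ψ.hom.app_res]
  rw [hψ, hθ]
  rfl

/-- The inverse of an isomorphism of triples. -/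
def Iso.symm {D D' : GluingData.{u} N} (φ : Iso D D') : Iso D' D where
  top := φ.top.symm
  field := φ.field.symm
  bot := φ.bot.symm
  field_smul g a := φ.field.injective (by rw [φ.field_smul]; simp)
  topIso_comm a := (appEquiv φ.bot _).injective <| by
    change φ.bot.hom.app _ _ = φ.bot.hom.app _ (φ.bot.inv.app _ _)
    rw [inv_hom_app, ← φ.topIso_comm]
    exact congrArg D'.topIso (inv_hom_app φ.top _ a)
  botIso_comm a := φ.field.injective <| by
    rw [← φ.botIso_comm, RingEquiv.apply_symm_apply]
    exact congrArg D'.botIso (inv_hom_app φ.bot _ a)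

end GluingData

end Gluing

/-! ### Gluing -/

section Closure

open FinGSet

variable {G : Type} [Group G]

theorem FinGSet.smul_inflate_of_mem {N : Subgroup G} [N.Normal] {X : FinGSet (G ⧸ N)}
    (x : inflate N X) {n : G} (hn : n ∈ N) : n • x = x := by
  change (n : G ⧸ N) • (show X from x) = x
  rw [(QuotientGroup.eq_one_iff n).2 hn]
  exact one_smul _ (show X from x)

/-- Induction on a `G`-set by splitting off free orbits, when every stabilizer is trivial or
contains `N`. -/
theorem FinGSet.induction_on_free_orbits {N : Subgroup G} (hst : ∀ H : Subgroup G, H = ⊥ ∨ N ≤ H)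
    {motive : FinGSet G → Prop} (fixed : ∀ X : FinGSet G, (∀ x : X, ∀ n ∈ N, n • x = x) → motive X)
    (free : ∀ (X : FinGSet G) (x : X), MulAction.stabilizer G x = ⊥ → (∃ n ∈ N, n • x ≠ x) →
      motive (sub X (orbitOf x)ᶜ) → motive X) (X : FinGSet G) : motive X := by
  induction hn : Nat.card X using Nat.strong_induction_on generalizing X with
  | _ n ih =>
    by_cases h : ∀ x : X, ∀ n ∈ N, n • x = x
    · exact fixed X h
    · push Not at h
      obtain ⟨x, n, hnN, hx⟩ := h
      refine free X x ((hst _).resolve_right fun h => hx (h hnN)) ⟨n, hnN, hx⟩ (ih _ ?_ _ rfl)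
      rw [← hn]
      exact Finite.card_subtype_lt (p := fun y => y ∈ (orbitOf x)ᶜ) (x := x)
        fun h => h ⟨1, one_smul G x⟩

theorem FinGSet.cartesian_fixedMap {N : Subgroup G} [N.Normal] {X Y : FinGSet G} (f : X →[G] Y)
    (hX : ∀ x : X, ∀ n ∈ N, n • x = x) :
    (∀ x : fixedPts N X, f x.1 = (fixedMap f x : fixedPts N Y).1) ∧
      ∀ (x : X) (y : fixedPts N Y), f x = y.1 → ∃! w : fixedPts N X, w.1 = x ∧ fixedMap f w = y :=
  ⟨fun _ => rfl, fun x _ h => ⟨⟨x, hX x⟩, ⟨rfl, Subtype.ext h⟩, fun _ hw => Subtype.ext hw.1⟩⟩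

/-- All points of a set inflated from `G/N` are fixed by `N`, and they form the original set. -/
def FinGSet.fromFixedPts {N : Subgroup G} [N.Normal] (X : FinGSet (G ⧸ N)) :
    fixedPts N (inflate N X) →[G ⧸ N] X where
  toFun x := x.1
  map_smul' := by
    rintro ⟨g⟩ x
    rfl

/-- The inverse of `fromFixedPts`. -/
def FinGSet.toFixedPts {N : Subgroup G} [N.Normal] (X : FinGSet (G ⧸ N)) :
    X →[G ⧸ N] fixedPts N (inflate N X) where
  toFun x := ⟨x, fun _ hn => smul_inflate_of_mem (X := X) x hn⟩
  map_smul' := by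
    rintro ⟨g⟩ x
    rfl

variable [Finite G] {N : Subgroup G} [N.Normal]

/-- A condition on functions on finite `G`-sets that is stable under products over fibres of maps
out of `N`-fixed `G`-sets and of `G/e → G/N`, and which is no condition on free orbits, is stable
under products over fibres of all maps. -/
theorem fiberProd_mem (hst : ∀ H : Subgroup G, H = ⊥ ∨ N ≤ H) {M : Type*} [CommMonoid M]
    (act : G → M → M) (P : ∀ X : FinGSet G, (X → M) → Prop)
    (hres : ∀ {X Y : FinGSet G} (f : X →[G] Y) (b : Y → M), P Y b → P X fun x => b (f x))
    (hmul : ∀ {X : FinGSet G} (a b : X → M), P X a → P X b → P X fun x => a x * b x)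
    (hone : ∀ {X : FinGSet G} (a : X → M), (∀ x, (∀ n ∈ N, n • x = x) → a x = 1) → P X a)
    (hfix : ∀ {X Y : FinGSet G} (f : X →[G] Y) (a : X → M), (∀ x : X, ∀ n ∈ N, n • x = x) →
      P X a → P Y (fiberProd f a))
    (hproj : ∀ a : free G → M, (∀ (g : G) x, a (g • x) = act g (a x)) →
      P _ (fiberProd (quotientProj N) a))
    {X Y : FinGSet G} (f : X →[G] Y) (a : X → M) (ha : ∀ g x, a (g • x) = act g (a x))
    (hP : P X a) : P Y (fiberProd f a) := by
  induction X using FinGSet.induction_on_free_orbits hst with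
  | fixed X h => exact hfix f a h hP
  | free X x hx _ ih =>
    have H : fiberProd f a = fun y => fiberProd (orbitMap (f x)) (fun g => a (orbitMap x g)) y *
        fiberProd (f.comp (incl (orbitOf x)ᶜ)) (fun z => a (incl (orbitOf x)ᶜ z)) y := by
      funext y
      rw [fiberProd_of_disjointUnion _ _ (isDisjointUnion_orbitMap hx), ← comp_orbitMap]
      rfl
    rw [H]
    refine hmul _ _ ?_ (ih _ _ (fun g z => ha g _) (hres _ _ hP))
    have ha' : ∀ (g : G) (y : free G), a (orbitMap x (g • y)) = act g (a (orbitMap x y)) :=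
      fun g y => by rw [map_smul, ha]
    by_cases hy : ∀ n ∈ N, n • f x = f x
    · -- the orbit map of a fixed point factors through `G/N`
      let y : fixedPts N Y := ⟨f x, hy⟩
      let j : inflate N (FinGSet.free (G ⧸ N)) →[G] Y :=
        (fixedIncl Y).comp (inflateMap N (orbitMap y))
      have hj : fiberProd (orbitMap (f x)) (fun g => a (orbitMap x g)) =
          fiberProd j (fiberProd (quotientProj N) fun g => a (orbitMap x g)) :=
        funext fun z => fiberProd_comp j (quotientProj N) _ z
      rw [hj]
      exact hfix j _ (fun x n hn => smul_inflate_of_mem x hn) (hproj _ ha')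
    · refine hone _ fun z hz => fiberProd_of_forall_ne _ _ fun g hg => hy fun n hn => ?_
      have hg' : f x = (show G from g)⁻¹ • z := eq_inv_smul_iff.2 hg
      rw [hg']
      exact (fixedSub N Y).smul_mem (show G from g)⁻¹ hz n hn

end Closure

namespace TambaraFunctor

/-- The Tambara functor given by subrings stable under restrictions, transfers and norms. -/
def sub {G : Type} [Group G] (k : TambaraFunctor.{u} G) (S : ∀ X, Subring (k.obj X))
    (hres : ∀ {X Y : FinGSet G} (f : X →[G] Y) (a), a ∈ S Y → k.res f a ∈ S X)
    (htr : ∀ {X Y : FinGSet G} (f : X →[G] Y) (a), a ∈ S X → k.tr f a ∈ S Y)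
    (hnm : ∀ {X Y : FinGSet G} (f : X →[G] Y) (a), a ∈ S X → k.nm f a ∈ S Y) :
    TambaraFunctor.{u} G where
  obj X := S X
  res f := (k.res f).restrict _ _ (hres f)
  tr f :=
    { toFun := fun a => ⟨k.tr f a, htr f a a.2⟩
      map_zero' := Subtype.ext (map_zero (k.tr f))
      map_add' := fun _ _ => Subtype.ext (map_add (k.tr f) _ _) }
  nm f :=
    { toFun := fun a => ⟨k.nm f a, hnm f a a.2⟩
      map_one' := Subtype.ext (map_one (k.nm f))
      map_mul' := fun _ _ => Subtype.ext (map_mul (k.nm f) _ _) }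
  res_id X a := Subtype.ext (k.res_id X a)
  tr_id X a := Subtype.ext (k.tr_id X a)
  nm_id X a := Subtype.ext (k.nm_id X a)
  res_comp g f a := Subtype.ext (k.res_comp g f a)
  tr_comp g f a := Subtype.ext (k.tr_comp g f a)
  nm_comp g f a := Subtype.ext (k.nm_comp g f a)
  subsingleton_of_isEmpty X hX :=
    have := k.subsingleton_of_isEmpty X hX
    inferInstance
  bijective_of_isDisjointUnion i j h := by
    constructor
    · intro a b hab
      obtain ⟨h₁, h₂⟩ := Prod.ext_iff.1 hab
      exact Subtype.ext (k.ext_of_disjointUnion h (Subtype.ext_iff.1 h₁) (Subtype.ext_iff.1 h₂))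
    · rintro ⟨a, b⟩
      obtain ⟨c, hc⟩ := (k.bijective_of_isDisjointUnion i j h).2 (a.1, b.1)
      obtain ⟨hc₁, hc₂⟩ := Prod.ext_iff.1 hc
      simp only at hc₁ hc₂
      refine ⟨⟨c, ?_⟩, Prod.ext (Subtype.ext hc₁) (Subtype.ext hc₂)⟩
      rw [← k.tr_res_add_tr_res h c, hc₁, hc₂]
      exact add_mem (htr i _ a.2) (htr j _ b.2)
  res_tr p q f g h a := Subtype.ext (k.res_tr p q f g h a)
  res_nm p q f g h a := Subtype.ext (k.res_nm p q f g h a)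
  nm_tr f g h p q e he a := Subtype.ext (k.nm_tr f g h p q e he a)

end TambaraFunctor

namespace GluingData

open FinGSet TambaraFunctor

variable {G : Type} [Group G] [Finite G] {N : Subgroup G} [N.Normal] (D : GluingData.{u} N)

/-- The condition that the restriction of a function to the `N`-fixed points comes from the top
piece of a triple. -/
def IsGlued (X : FinGSet G) (f : X → D.field) : Prop :=
  ∃ a : D.top.obj (fixedPts N X), ∀ x : fixedPts N X, f x.1 = D.connectingMap (D.top.eval x a)

variable {D}

theorem IsGlued.res {X Y : FinGSet G} (f : X →[G] Y) {b : Y → D.field} (hb : D.IsGlued Y b) :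
    D.IsGlued X fun x => b (f x) := by
  obtain ⟨a, ha⟩ := hb
  refine ⟨D.top.res (fixedMap f) a, fun x => ?_⟩
  rw [eval_res]
  exact ha (fixedMap f x)

theorem IsGlued.of_eq_zero {X : FinGSet G} (a : X → D.field)
    (ha : ∀ x, (∀ n ∈ N, n • x = x) → a x = 0) : D.IsGlued X a :=
  ⟨0, fun x => by rw [map_zero, map_zero]; exact ha x.1 x.2⟩

theorem IsGlued.of_eq_one {X : FinGSet G} (a : X → D.field)
    (ha : ∀ x, (∀ n ∈ N, n • x = x) → a x = 1) : D.IsGlued X a :=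
  ⟨1, fun x => by rw [map_one, map_one]; exact ha x.1 x.2⟩

theorem IsGlued.add {X : FinGSet G} {a b : X → D.field} (ha : D.IsGlued X a)
    (hb : D.IsGlued X b) : D.IsGlued X fun x => a x + b x := by
  obtain ⟨c, hc⟩ := ha
  obtain ⟨d, hd⟩ := hb
  exact ⟨c + d, fun x => by rw [map_add, map_add, ← hc, ← hd]⟩

theorem IsGlued.mul {X : FinGSet G} {a b : X → D.field} (ha : D.IsGlued X a)
    (hb : D.IsGlued X b) : D.IsGlued X fun x => a x * b x := by
  obtain ⟨c, hc⟩ := ha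
  obtain ⟨d, hd⟩ := hb
  exact ⟨c * d, fun x => by rw [map_mul, map_mul, ← hc, ← hd]⟩

theorem IsGlued.neg {X : FinGSet G} {a : X → D.field} (ha : D.IsGlued X a) :
    D.IsGlued X fun x => - a x := by
  obtain ⟨c, hc⟩ := ha
  exact ⟨-c, fun x => by rw [map_neg, map_neg, ← hc]⟩

theorem IsGlued.fiberSum_of_fixed {X Y : FinGSet G} (f : X →[G] Y) {a : X → D.field}
    (hX : ∀ x : X, ∀ n ∈ N, n • x = x) (ha : D.IsGlued X a) : D.IsGlued Y (fiberSum f a) := by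
  obtain ⟨c, hc⟩ := ha
  refine ⟨D.top.tr (fixedMap f) c, fun y => ?_⟩
  rw [eval_tr, fiberSum_of_cartesian _ _ f (fun y : fixedPts N Y => y.1) (cartesian_fixedMap f hX)]
  simp only [hc]
  exact (map_fiberSum D.connectingMap.toAddMonoidHom _ _ _).symm

theorem IsGlued.fiberProd_of_fixed {X Y : FinGSet G} (f : X →[G] Y) {a : X → D.field}
    (hX : ∀ x : X, ∀ n ∈ N, n • x = x) (ha : D.IsGlued X a) : D.IsGlued Y (fiberProd f a) := by
  obtain ⟨c, hc⟩ := ha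
  refine ⟨D.top.nm (fixedMap f) c, fun y => ?_⟩
  rw [eval_nm, fiberProd_of_cartesian _ _ f (fun y : fixedPts N Y => y.1) (cartesian_fixedMap f hX)]
  simp only [hc]
  exact (map_fiberProd D.connectingMap.toMonoidHom _ _ _).symm

/-- For inflated sets the condition is to come from the top piece. -/
theorem isGlued_inflate_iff {X : FinGSet (G ⧸ N)} {f : inflate N X → D.field} :
    D.IsGlued (inflate N X) f ↔ ∃ a : D.top.obj X, ∀ x : X,
      f x = D.connectingMap (D.top.eval x a) := by
  constructor
  · rintro ⟨a, ha⟩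
    refine ⟨D.top.res (toFixedPts X) a, fun x => ?_⟩
    rw [eval_res]
    exact ha (toFixedPts X x)
  · rintro ⟨a, ha⟩
    refine ⟨D.top.res (fromFixedPts X) a, fun x => ?_⟩
    rw [eval_res]
    exact ha x.1

/-- An equivariant function on `G/N` is glued if its value at the base point comes from the ring
`top((G/N)/e)`. -/
theorem isGlued_quotient {p : ℕ} (hD : D.IsCompatible p)
    {f : inflate N (free (G ⧸ N)) → D.field} (hf : ∀ (g : G) x, f (g • x) = g • f x)
    (t : D.top.bottom) (ht : f (1 : G ⧸ N) = D.connectingMap t) : D.IsGlued _ f := by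
  refine isGlued_inflate_iff.2 ⟨t, fun x => ?_⟩
  obtain ⟨g, rfl⟩ := QuotientGroup.mk_surjective (s := N) x
  rw [eval_bottom, hD.connectingMap_smul, ← ht]
  exact (congrArg f (mul_one (g : G ⧸ N)).symm).trans (hf g (1 : G ⧸ N))

/-- The fibre of `G/e → G/N` over the base point is `N`. -/
theorem cartesian_toPoint : (∀ n : N, quotientProj N (n : G) = (1 : G ⧸ N)) ∧
    ∀ (g : free G) (y : point N), quotientProj N g = (1 : G ⧸ N) →
      ∃! n : free N, ((n : N) : G) = g ∧ toPoint N n = y :=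
  ⟨fun n => (QuotientGroup.eq_one_iff _).2 n.2, fun g _ h =>
    ⟨⟨g, (QuotientGroup.eq_one_iff _).1 h⟩, ⟨rfl, rfl⟩, fun _ hn => Subtype.ext hn.1⟩⟩

theorem resTopBottom_eq_eval {k : TambaraFunctor.{u} G} (a : k.topLevel) :
    k.resTopBottom a = k.eval (X := point G) PUnit.unit a := rfl

/-- Over the base point of `G/N` this sum is the value of a transfer `bot(N/e) → bot(N/N)`. -/
theorem isGlued_fiberSum_quotientProj {p : ℕ} (hD : D.IsCompatible p) (a : free G → D.field)
    (ha : ∀ (g : G) x, a (g • x) = g • a x) : D.IsGlued _ (fiberSum (quotientProj N) a) := by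
  refine isGlued_quotient hD (fiberSum_smul _ a ha)
    (D.topIso.symm (D.bot.tr (toPoint N) (D.botIso.symm (a (1 : G))))) ?_
  rw [connectingMap_apply, RingEquiv.apply_symm_apply, resTopBottom_eq_eval, eval_tr]
  refine (fiberSum_of_cartesian (fun n : free N => ((n : N) : G)) (toPoint N) (quotientProj N)
    (fun _ : point N => (1 : G ⧸ N)) cartesian_toPoint a PUnit.unit).trans ?_
  refine Eq.trans (fiberSum_congr _ fun n _ => ?_)
    (map_fiberSum (D.botIso : D.bot.bottom →+* D.field).toAddMonoidHom _ _ _).symm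
  refine Eq.trans ?_ (hD.botIso_smul n _).symm
  rw [RingEquiv.apply_symm_apply, ← ha]
  exact congrArg a (mul_one _).symm

/-- Over the base point of `G/N` this product is the value of a norm `bot(N/e) → bot(N/N)`. -/
theorem isGlued_fiberProd_quotientProj {p : ℕ} (hD : D.IsCompatible p) (a : free G → D.field)
    (ha : ∀ (g : G) x, a (g • x) = g • a x) : D.IsGlued _ (fiberProd (quotientProj N) a) := by
  refine isGlued_quotient hD (fiberProd_smul _ a ha)
    (D.topIso.symm (D.bot.nm (toPoint N) (D.botIso.symm (a (1 : G))))) ?_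
  rw [connectingMap_apply, RingEquiv.apply_symm_apply, resTopBottom_eq_eval, eval_nm]
  refine (fiberProd_of_cartesian (fun n : free N => ((n : N) : G)) (toPoint N) (quotientProj N)
    (fun _ : point N => (1 : G ⧸ N)) cartesian_toPoint a PUnit.unit).trans ?_
  refine Eq.trans (fiberProd_congr _ fun n _ => ?_)
    (map_fiberProd (D.botIso : D.bot.bottom →+* D.field).toMonoidHom _ _ _).symm
  refine Eq.trans ?_ (hD.botIso_smul n _).symm
  rw [RingEquiv.apply_symm_apply, ← ha]
  exact congrArg a (mul_one _).symm

theorem IsGlued.fiberProd (hst : ∀ H : Subgroup G, H = ⊥ ∨ N ≤ H) {p : ℕ}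
    (hD : D.IsCompatible p) {X Y : FinGSet G} (f : X →[G] Y) {a : X → D.field}
    (ha : ∀ (g : G) x, a (g • x) = g • a x) (h : D.IsGlued X a) : D.IsGlued Y (fiberProd f a) :=
  fiberProd_mem hst (fun g v => g • v) D.IsGlued (fun f _ hb => hb.res f) (fun _ _ => .mul)
    (fun a => .of_eq_one a) (fun f _ => .fiberProd_of_fixed f) (isGlued_fiberProd_quotientProj hD)
    f a ha h

theorem IsGlued.fiberSum (hst : ∀ H : Subgroup G, H = ⊥ ∨ N ≤ H) {p : ℕ}
    (hD : D.IsCompatible p) {X Y : FinGSet G} (f : X →[G] Y) {a : X → D.field}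
    (ha : ∀ (g : G) x, a (g • x) = g • a x) (h : D.IsGlued X a) : D.IsGlued Y (fiberSum f a) :=
  fiberProd_mem (M := Multiplicative D.field) hst (fun g v => .ofAdd (g • v.toAdd))
    (fun X a => D.IsGlued X fun x => (a x).toAdd) (fun f _ hb => hb.res f) (fun _ _ => .add)
    (fun a => .of_eq_zero fun x => (a x).toAdd) (fun f _ => .fiberSum_of_fixed f)
    (fun a ha => isGlued_fiberSum_quotientProj hD (fun x => (a x).toAdd) ha)
    f (fun x => .ofAdd (a x)) ha h

end GluingData

namespace GluingData

open FinGSet TambaraFunctor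

variable {G : Type} [Group G] [Finite G] {N : Subgroup G} [N.Normal] {D : GluingData.{u} N}

variable (D) in
/-- The equivariant functions whose restriction to the `N`-fixed points comes from the top piece. -/
def gluedFunctions (X : FinGSet G) : Subring (equivariantFunctions D.field X) where
  carrier := {f | D.IsGlued X f.1}
  mul_mem' ha hb := ha.mul hb
  one_mem' := .of_eq_one _ fun _ _ => rfl
  add_mem' ha hb := ha.add hb
  zero_mem' := .of_eq_zero _ fun _ _ => rfl
  neg_mem' ha := ha.neg

/-- The Tambara functor obtained by gluing the pieces of a compatible triple: the subfunctor of the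
fixed point functor of the field consisting of the functions which on `N`-fixed points come from
the top piece. -/
noncomputable def glue (hst : ∀ H : Subgroup G, H = ⊥ ∨ N ≤ H) {p : ℕ} (hD : D.IsCompatible p) :
    TambaraFunctor.{u} G :=
  (fixedFunctor D.field).sub D.gluedFunctions (fun f _ ha => IsGlued.res f ha)
    (fun f a ha => IsGlued.fiberSum hst hD f a.2 ha)
    (fun f a ha => IsGlued.fiberProd hst hD f a.2 ha)

theorem IsCompatible.connectingMap_injective {p : ℕ} (hD : D.IsCompatible p) :
    Function.Injective D.connectingMap :=
  D.botIso.injective.comp (((isClarified_iff _).1 hD.bot_clarified.1).2.injective_resTopBottom.comp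
    D.topIso.injective)

section

variable (hst : ∀ H : Subgroup G, H = ⊥ ∨ N ≤ H) {p : ℕ} (hD : D.IsCompatible p)

/-- The function corresponding to an element of the glued Tambara functor. -/
def glueFun {X : FinGSet G} (a : (glue hst hD).obj X) : X → D.field := a.1.1

theorem glueFun_ext {X : FinGSet G} {a b : (glue hst hD).obj X}
    (h : ∀ x, glueFun hst hD a x = glueFun hst hD b x) : a = b :=
  Subtype.ext (Subtype.ext (funext h))

theorem glueFun_smul {X : FinGSet G} (a : (glue hst hD).obj X) (g : G) (x : X) :
    glueFun hst hD a (g • x) = g • glueFun hst hD a x := a.1.2 g x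

theorem glueFun_eval {X : FinGSet G} (a : (glue hst hD).obj X) (x : X) :
    glueFun hst hD ((glue hst hD).eval x a) (1 : G) = glueFun hst hD a x :=
  congrArg (glueFun hst hD a) (one_smul G x)

theorem isFaithful_glue : (glue hst hD).IsFaithful := fun _ a b h =>
  glueFun_ext hst hD fun x => (glueFun_eval hst hD a x).symm.trans
    ((congrArg (glueFun hst hD · (1 : G)) (h x)).trans (glueFun_eval hst hD b x))

/-- The bottom ring of the glued Tambara functor is the field of the triple. -/
noncomputable def glueBottomEquiv (hN : N ≠ ⊥) : (glue hst hD).bottom ≃+* D.field :=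
  RingEquiv.ofBijective (show (glue hst hD).bottom →+* D.field from
    { toFun := fun a => glueFun hst hD a (1 : G)
      map_one' := rfl
      map_mul' := fun _ _ => rfl
      map_zero' := rfl
      map_add' := fun _ _ => rfl }) <| by
    constructor
    · intro a b hab
      refine glueFun_ext hst hD fun (g : G) => ?_
      have H : ∀ c : (glue hst hD).bottom,
          glueFun hst hD c g = g • glueFun hst hD c (1 : G) := fun c =>
        (congrArg (glueFun hst hD c) (mul_one g).symm).trans (glueFun_smul hst hD c g (1 : G))
      rw [H, H]
      exact congrArg (g • ·) hab
    · intro v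
      refine ⟨⟨⟨fun g : G => g • v, fun g (h : G) => mul_smul g h v⟩, .of_eq_zero _ ?_⟩,
        one_smul G v⟩
      -- there are no `N`-fixed points on `G/e`
      intro (g : G) hg
      obtain ⟨n, hn⟩ := N.ne_bot_iff_exists_ne_one.1 hN
      exact absurd (Subtype.ext (mul_eq_right.1 (hg n n.2))) hn

theorem glueBottomEquiv_smul (hN : N ≠ ⊥) (g : G) (a : (glue hst hD).bottom) :
    glueBottomEquiv hst hD hN (g • a) = g • glueBottomEquiv hst hD hN a := by
  have h : glueFun hst hD a (1 * g : G) = glueFun hst hD a (g * 1 : G) :=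
    congrArg (glueFun hst hD a) ((one_mul g).trans (mul_one g).symm)
  exact h.trans (glueFun_smul hst hD a g (1 : G))

theorem isClarifiedOfChar_glue (hN : N ≠ ⊥) : (glue hst hD).IsClarifiedOfChar p := by
  refine ⟨(isClarified_iff _).2 ⟨MulEquiv.isField hD.isField
    (glueBottomEquiv hst hD hN).toMulEquiv, isFaithful_glue hst hD⟩, ?_⟩
  have := hD.bot_clarified.2
  let e := (glueBottomEquiv hst hD hN).trans D.botIso.symm
  exact e.toRingHom.charP e.injective p

/-- The map from the top piece of a triple to the top piece of the glued Tambara functor. -/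
noncomputable def toTopPieceGlue : D.top ⟶ (glue hst hD).topPiece N where
  app X :=
    { toFun := fun a => ⟨⟨fun x : X => D.connectingMap (D.top.eval x a), fun g (x : X) => by
        rw [← hD.connectingMap_smul, ← eval_smul]; rfl⟩, isGlued_inflate_iff.2 ⟨a, fun _ => rfl⟩⟩
      map_one' := glueFun_ext hst hD fun x => by
        exact (congrArg _ (map_one _)).trans (map_one _)
      map_mul' := fun a b => glueFun_ext hst hD fun x => by
        exact (congrArg _ (map_mul _ a b)).trans (map_mul _ _ _)
      map_zero' := glueFun_ext hst hD fun x => by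
        exact (congrArg _ (map_zero _)).trans (map_zero _)
      map_add' := fun a b => glueFun_ext hst hD fun x => by
        exact (congrArg _ (map_add _ a b)).trans (map_add _ _ _) }
  app_res f a := glueFun_ext hst hD fun x => congrArg D.connectingMap (D.top.eval_res f x a)
  app_tr f a := glueFun_ext hst hD fun x => (congrArg D.connectingMap (D.top.eval_tr f x a)).trans
    (map_fiberSum D.connectingMap.toAddMonoidHom _ _ _)
  app_nm f a := glueFun_ext hst hD fun x => (congrArg D.connectingMap (D.top.eval_nm f x a)).trans
    (map_fiberProd D.connectingMap.toMonoidHom _ _ _)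

theorem bijective_toTopPieceGlue (X : FinGSet (G ⧸ N)) :
    Function.Bijective ((toTopPieceGlue hst hD).app X) := by
  constructor
  · intro a b hab
    refine ((isClarified_iff _).1 hD.top_clarified.1).2 fun x => hD.connectingMap_injective ?_
    exact congrArg (fun c => glueFun hst hD (X := inflate N X) c x) hab
  · intro f
    obtain ⟨a, ha⟩ := isGlued_inflate_iff.1 f.2
    exact ⟨a, glueFun_ext hst hD fun x => (ha x).symm⟩

end

/-- Every compatible triple is the triple of a clarified Tambara field. -/
theorem exists_decompose_iso (hst : ∀ H : Subgroup G, H = ⊥ ∨ N ≤ H) (hN : N ≠ ⊥)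
    (hN' : ∀ H : Subgroup N, H = ⊥ ∨ H = ⊤) {p : ℕ} (hD : D.IsCompatible p) :
    ∃ k : TambaraFunctor.{u} G, k.IsClarifiedOfChar p ∧ Nonempty (Iso (k.decompose N) D) := by
  have hk := isClarifiedOfChar_glue hst hD hN
  refine ⟨glue hst hD, hk, ?_⟩
  let φ := (glueBottomEquiv hst hD hN).symm
  have hφ : ∀ v, glueBottomEquiv hst hD hN (φ v) = v := fun v =>
    (glueBottomEquiv hst hD hN).apply_symm_apply v
  obtain ⟨ε⟩ := exists_iso (D' := (glue hst hD).decompose N) hN' hD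
    (hk.isCompatible_decompose N)
    (isoOfBijective (toTopPieceGlue hst hD) (bijective_toTopPieceGlue hst hD)) φ
    (fun g v => (glueBottomEquiv hst hD hN).injective (by
      exact (hφ _).trans
        ((glueBottomEquiv_smul hst hD hN g _).trans (congrArg (g • ·) (hφ v))).symm))
    (fun a => (glueBottomEquiv hst hD hN).injective ((hφ _).trans (by
      refine Eq.trans ?_ (congrArg (glueBottomEquiv hst hD hN)
        (connectingMap_decompose N (glue hst hD) ((toTopPieceGlue hst hD).app _ a)).symm)
      exact congrArg D.connectingMap (eval_bottom_one D.top a).symm)))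
  exact ⟨ε.symm⟩

end GluingData

/-! ### Isomorphisms of triples -/

section Lift

open FinGSet TambaraFunctor

variable {G : Type} [Group G] [Finite G] {N : Subgroup G} [N.Normal]

namespace GluingData.Iso

theorem field_connectingMap {D D' : GluingData.{u} N} (φ : Iso D D') (a : D.top.bottom) :
    φ.field (D.connectingMap a) = D'.connectingMap (φ.top.hom.app _ a) := by
  rw [connectingMap_apply, connectingMap_apply, φ.topIso_comm, ← φ.botIso_comm]
  exact congrArg D'.botIso (φ.bot.hom.app_res _ _)

variable {k k' : TambaraFunctor.{u} G} (φ : Iso (k.decompose N) (k'.decompose N))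

/-- On inflated sets, `φ.top` is determined by `φ.field`. -/
theorem eval_top {X : FinGSet (G ⧸ N)} (x : X) (a : k.obj (inflate N X)) :
    k'.eval (X := inflate N X) x (φ.top.hom.app X a) =
      φ.field (k.eval (X := inflate N X) x a) := by
  have H : ∀ (l : TambaraFunctor.{u} G) (b : l.obj (inflate N X)),
      l.eval (X := inflate N X) x b =
        (l.decompose N).connectingMap ((l.topPiece N).eval x b) := fun l b =>
    (res_quotientProj_eval N l x b).symm.trans (connectingMap_decompose N l _).symm
  exact (H k' _).trans ((congrArg (k'.decompose N).connectingMap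
    (app_eval φ.top.hom x a).symm).trans
      ((φ.field_connectingMap _).symm.trans (congrArg φ.field (H k a).symm)))

/-- On induced sets, `φ.bot` is determined by `φ.field`. -/
theorem eval_bot {X : FinGSet N} (x : X) (a : k.obj (ind N X)) :
    k'.eval (indMk 1 x) (φ.bot.hom.app X a) = φ.field (k.eval (indMk 1 x) a) := by
  exact (res_freeToIndFree_eval N k' x _).symm.trans ((congrArg (k'.decompose N).botIso
    (app_eval φ.bot.hom x a).symm).trans ((φ.botIso_comm ((k.restrict N).eval x a)).trans
      (congrArg φ.field (res_freeToIndFree_eval N k x a))))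

/-- Isomorphisms of triples preserve the possible values at every point: there is no condition at a
point with trivial stabilizer, and at an `N`-fixed point the values come from the top piece. -/
theorem exists_eval_eq (hst : ∀ H : Subgroup G, H = ⊥ ∨ N ≤ H) {X : FinGSet G} (x : X)
    (a : k.obj X) : ∃ b : k'.obj X, k'.eval x b = φ.field (k.eval x a) := by
  rcases hst (MulAction.stabilizer G x) with h | h
  · exact k'.exists_eval_eq_of_stabilizer_eq_bot h _
  · let y : fixedPts N X := ⟨x, fun n hn => MulAction.mem_stabilizer_iff.1 (h hn)⟩
    have hinj : Function.Injective (fixedIncl X : inflate N (fixedPts N X) →[G] X) :=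
      fun _ _ h => Subtype.ext h
    refine ⟨k'.tr (fixedIncl X) (φ.top.hom.app _ (k.res (fixedIncl X) a)), ?_⟩
    refine (eval_res k' (fixedIncl X) y _).symm.trans ?_
    refine (congrArg (k'.eval (X := inflate N (fixedPts N X)) y)
      (res_tr_of_injective k' hinj _)).trans ?_
    exact (φ.eval_top y _).trans (congrArg φ.field (k.eval_res (fixedIncl X) y a))

/-- Isomorphisms of triples of clarified Tambara fields lift uniquely. -/
theorem existsUnique_isInducedBy (hst : ∀ H : Subgroup G, H = ⊥ ∨ N ≤ H) {p : ℕ}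
    (hk : k.IsClarifiedOfChar p) (hk' : k'.IsClarifiedOfChar p) :
    ∃! ψ : k ≅ k', φ.IsInducedBy ψ := by
  have hf := ((isClarified_iff _).1 hk.1).2
  have hf' := ((isClarified_iff _).1 hk'.1).2
  obtain ⟨ψ, hψ⟩ := exists_iso_of_bottom hf hf' φ.field φ.field_smul
    (fun X x a => φ.exists_eval_eq hst x a) fun X x b => by
      obtain ⟨a, ha⟩ := φ.symm.exists_eval_eq hst x b
      exact ⟨a, by rw [ha]; exact (φ.field.apply_symm_apply _).symm⟩
  refine ⟨ψ, ⟨fun X a => hf' fun x => ?_, fun a => (hψ a).symm, fun X a => ?_⟩, ?_⟩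
  · exact (φ.eval_top x a).trans ((hψ _).symm.trans (app_eval ψ.hom (X := inflate N X) x a))
  · refine hf'.restrict N fun x => (k'.decompose N).botIso.injective ?_
    refine (res_freeToIndFree_eval N k' x _).trans
      (Eq.trans ?_ (res_freeToIndFree_eval N k' x _).symm)
    exact (φ.eval_bot x a).trans ((hψ _).symm.trans (app_eval ψ.hom (X := ind N X) _ a))
  · intro ψ' hψ'
    refine Iso.ext (hf'.hom_ext fun a => ?_)
    rw [hψ]
    exact (hψ'.2.1 a).symm

end GluingData.Iso

/-! ### Tambara functors whose triple is compatible -/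

namespace TambaraFunctor

/-- Faithfulness can be checked on the top piece and on the restriction from `G/N` to `G/e`. -/
theorem isFaithful_of_topPiece (hst : ∀ H : Subgroup G, H = ⊥ ∨ N ≤ H) {k : TambaraFunctor.{u} G}
    (htop : (k.topPiece N).IsFaithful) (hinj : Function.Injective (k.res (quotientProj N))) :
    k.IsFaithful := by
  intro X
  induction X using FinGSet.induction_on_free_orbits hst with
  | fixed X hX =>
    intro a b h
    have hbij : Function.Bijective (fixedIncl X : inflate N (fixedPts N X) →[G] X) :=
      ⟨fun _ _ h => Subtype.ext h, fun x => ⟨⟨x, hX x⟩, rfl⟩⟩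
    refine k.res_injective_of_bijective hbij (htop fun x => hinj ?_)
    refine (res_quotientProj_eval N k x _).trans
      (Eq.trans ?_ (res_quotientProj_eval N k x _).symm)
    exact (k.eval_res (fixedIncl X) x a).trans ((h _).trans (k.eval_res (fixedIncl X) x b).symm)
  | free X x hx _ ih =>
    intro a b h
    refine k.ext_of_disjointUnion (isDisjointUnion_orbitMap hx) (h x) (ih fun y => ?_)
    rw [eval_res, eval_res, h]

/-- A Tambara functor whose triple is isomorphic to a compatible one is a clarified field. -/
theorem isClarifiedOfChar_of_iso (hst : ∀ H : Subgroup G, H = ⊥ ∨ N ≤ H) {p : ℕ}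
    {k : TambaraFunctor.{u} G} {D : GluingData.{u} N} (hD : D.IsCompatible p)
    (φ : GluingData.Iso (k.decompose N) D) : k.IsClarifiedOfChar p := by
  have htop := (((isClarified_iff _).1 hD.top_clarified.1).2).of_iso φ.top
  have hbot := (((isClarified_iff _).1 hD.bot_clarified.1).2).of_iso φ.bot
  have hinj : Function.Injective (k.res (quotientProj N)) := by
    have : Function.Injective (k.decompose N).connectingMap :=
      (k.decompose N).botIso.injective.comp
        (hbot.injective_resTopBottom.comp (k.decompose N).topIso.injective)
    intro a b hab
    refine this ?_
    rw [connectingMap_decompose, connectingMap_decompose, hab]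
  refine ⟨(isClarified_iff _).2 ⟨MulEquiv.isField hD.isField φ.field.toMulEquiv,
    isFaithful_of_topPiece hst htop hinj⟩, ?_⟩
  have := hD.bot_clarified.2
  let e : k.bottom ≃+* D.bot.bottom := RingEquiv.trans φ.field D.botIso.symm
  exact e.toRingHom.charP e.injective p

end TambaraFunctor

/-- The identity of a triple. -/
def GluingData.Iso.refl (D : GluingData.{u} N) : GluingData.Iso D D where
  top := CategoryTheory.Iso.refl _
  field := RingEquiv.refl _
  bot := CategoryTheory.Iso.refl _
  field_smul _ _ := rfl
  topIso_comm _ := rfl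
  botIso_comm _ := rfl

end Lift

/-! ### Subgroups of cyclic `p`-groups -/

section Cyclic

variable {G : Type} [CommGroup G] [Finite G] {p n : ℕ}

/-- Nontrivial subgroups of a cyclic `p`-group contain the subgroup of order `p`. -/
theorem eq_bot_or_le_of_card_eq_prime [IsCyclic G] (hp : p.Prime) (hG : Nat.card G = p ^ n)
    {N : Subgroup G} (hN : Nat.card N = p) (H : Subgroup G) : H = ⊥ ∨ N ≤ H := by
  have := Fact.mk hp
  -- a subgroup of order `p` is the `p`-torsion subgroup
  have key : ∀ K : Subgroup G, Nat.card K = p → K = (powMonoidHom p : G →* G).ker := by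
    intro K hK
    refine Subgroup.eq_of_le_of_card_ge (fun x hx => ?_) ?_
    · have := pow_card_eq_one' (x := (⟨x, hx⟩ : K))
      rw [hK] at this
      exact congrArg Subtype.val this
    · rw [IsCyclic.card_powMonoidHom_ker, hK]
      exact Nat.gcd_le_right _ hp.pos
  refine or_iff_not_imp_left.2 fun hH => ?_
  have hpH : p ∣ Nat.card H := by
    have h₁ := Subgroup.card_subgroup_dvd_card H
    rw [hG, Nat.dvd_prime_pow hp] at h₁
    obtain ⟨m, -, hm⟩ := h₁
    rw [hm]
    refine dvd_pow_self p fun h => hH ?_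
    rw [h, pow_zero] at hm
    exact Subgroup.card_eq_one.1 hm
  obtain ⟨x, hx⟩ := exists_prime_orderOf_dvd_card' p hpH
  rw [key N hN, ← key (Subgroup.zpowers (x : G))
    (by rw [Nat.card_zpowers, Subgroup.orderOf_coe, hx])]
  exact Subgroup.zpowers_le.2 x.2

theorem exists_subgroup_card_eq_prime (hp : p.Prime) (hn : n ≠ 0) (hG : Nat.card G = p ^ n) :
    ∃ N : Subgroup G, Nat.card N = p := by
  have := Fact.mk hp
  obtain ⟨x, hx⟩ := exists_prime_orderOf_dvd_card' (G := G) p (hG ▸ dvd_pow_self p hn)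
  exact ⟨Subgroup.zpowers x, by rw [Nat.card_zpowers, hx]⟩

end Cyclic

/-! ### Iterated gluing -/

theorem IsIteratedGluing.exists_card_eq {p : ℕ} {G : Type} [CommGroup G] [Finite G]
    {k : TambaraFunctor.{u} G} (h : IsIteratedGluing p G k) : ∃ n, Nat.card G = p ^ n := by
  induction h with
  | base G hG => exact ⟨1, by rw [hG, pow_one]⟩
  | glue G N hN D hD htop k hk ih =>
    obtain ⟨n, hn⟩ := ih
    exact ⟨n + 1, by rw [Subgroup.card_eq_card_quotient_mul_card_subgroup N, hn, hN, pow_succ]⟩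

theorem IsIteratedGluing.isClarifiedOfChar {p : ℕ} (hp : p.Prime) {G : Type} [CommGroup G]
    [Finite G] {k : TambaraFunctor.{u} G} (h : IsIteratedGluing p G k) :
    k.IsClarifiedOfChar p := by
  induction h with
  | base G hG k hk => exact hk
  | glue G N hN D hD htop k hk _ =>
    obtain ⟨n, hn⟩ := (IsIteratedGluing.glue G N hN D hD htop k hk).exists_card_eq
    obtain ⟨φ⟩ := hk
    exact TambaraFunctor.isClarifiedOfChar_of_iso
      (eq_bot_or_le_of_card_eq_prime hp hn hN) hD φ

theorem isIteratedGluing_of_isClarifiedOfChar {p : ℕ} (hp : p.Prime) {n : ℕ} (G : Type)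
    [CommGroup G] [Finite G] [IsCyclic G] (hG : Nat.card G = p ^ (n + 1))
    {k : TambaraFunctor.{u} G} (hk : k.IsClarifiedOfChar p) : IsIteratedGluing p G k := by
  induction n generalizing G with
  | zero => exact .base G (by rw [hG, zero_add, pow_one]) k hk
  | succ n ih =>
    obtain ⟨N, hN⟩ := exists_subgroup_card_eq_prime hp (Nat.succ_ne_zero _) hG
    have hD := hk.isCompatible_decompose N
    have hQ : Nat.card (G ⧸ N) = p ^ (n + 1) := by
      have := Subgroup.card_eq_card_quotient_mul_card_subgroup N
      rw [hG, hN, pow_succ] at this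
      exact (Nat.eq_of_mul_eq_mul_right hp.pos this).symm
    exact .glue G N hN _ hD (ih (G ⧸ N) hQ hD.top_clarified) k ⟨.refl _⟩

theorem mainTheorem6 (p : ℕ) (hp : p.Prime) (n : ℕ) (hn : 1 ≤ n)
    (G : Type) [CommGroup G] [Finite G] [IsCyclic G] (hG : Nat.card G = p ^ n) :
    (∀ N : Subgroup G, Nat.card N = p →
      (∀ k : TambaraFunctor.{u} G, k.IsClarifiedOfChar p → (k.decompose N).IsCompatible p) ∧
      (∀ D : GluingData.{u} N, D.IsCompatible p →
        ∃ k : TambaraFunctor.{u} G, k.IsClarifiedOfChar p ∧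
          Nonempty (GluingData.Iso (k.decompose N) D)) ∧
      (∀ k k' : TambaraFunctor.{u} G, k.IsClarifiedOfChar p → k'.IsClarifiedOfChar p →
        ∀ φ : GluingData.Iso (k.decompose N) (k'.decompose N),
          ∃! ψ : k ≅ k', φ.IsInducedBy ψ)) ∧
    (∀ k : TambaraFunctor.{u} G, k.IsClarifiedOfChar p ↔ IsIteratedGluing p G k) := by
  refine ⟨fun N hN => ?_, fun k => ⟨fun hk => ?_, fun hk => hk.isClarifiedOfChar hp⟩⟩
  · have hst := eq_bot_or_le_of_card_eq_prime hp hG hN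
    refine ⟨fun k hk => hk.isCompatible_decompose N, fun D hD => ?_,
      fun k k' hk hk' φ => φ.existsUnique_isInducedBy hst hk hk'⟩
    refine GluingData.exists_decompose_iso hst (fun h => hp.one_lt.ne' ?_) (fun H => ?_) hD
    · rw [← hN, h, Subgroup.card_bot]
    · have := Fact.mk (hN.symm ▸ hp : (Nat.card N).Prime)
      exact Subgroup.eq_bot_or_eq_top_of_prime_card H
  · obtain ⟨m, rfl⟩ := Nat.exists_eq_add_of_le' hn
    exact isIteratedGluing_of_isClarifiedOfChar hp G hG hk
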